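/- Let $\Phi=\{\pm a,\pm b,\pm(a+b),\pm(2a+b),\pm(3a+b),\pm(3a+2b)\}$ be the root system of type $G_2$ with fundamental roots $a$ (short) and $b$ (long), where $(a,a)=2$, $(a,b)=-3$, $(b,b)=6$. Let $L$ be the complex simple Lie algebra of type $G_2$ with a Chevalley basis $\{h_a,h_b\}\cup\{e_r : r\in\Phi\}$. This means that, with $h_r$ the element of $\mathbb{C}h_a+\mathbb{C}h_b$ given by $(r,r)h_r=m(a,a)h_a+n(b,b)h_b$ for $r=ma+nb\in\Phi$, one has $[h_r,h_s]=0$, $[h_r,e_s]=\frac{2(r,s)}{(r,r)}e_s$, $[e_r,e_{-r}]=h_r$, $[e_r,e_s]=0$ if $0\neq r+s\notin\Phi$, and $[e_r,e_s]=N_{r,s}e_{r+s}$ if $r+s\in\Phi$, where $N_{r,s}=\pm(p+1)$ and $p$ is the largest integer such that $s-ir\in\Phi$ for $0\le i\le p$. Assume that the structure constants of the extraspecial pairs are positive: $N_{a,b}>0$, $N_{a,a+b}>0$, $N_{a,2a+b}>0$, $N_{b,3a+b}>0$. Let $K$ be a commutative ring with identity, let $L_{\mathbb Z}$ be the $\mathbb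 Z$-span of the Chevalley basis and $L_K=K\otimes_{\mathbb Z}L_{\mathbb Z}$. For $r\in\Phi$ and $t\in K$ let $x_r(t)=\exp(t\,\mathrm{ad}\,e_r)=\sum_{i=0}^{3}t^i\otimes\frac{(\mathrm{ad}\,e_r)^i}{i!}$, an element of the Chevalley group of type $G_2$ over $K$, that is, of the group of automorphisms of $L_K$ generated by all these root elements. Write $[g,h]=g^{-1}h^{-1}gh$. Then for all $t,u\in K$: 1. $[x_{b}(u),x_{a}(t)]=x_{a+b}(-tu)\,x_{2a+b}(t^2u)\,x_{3a+b}(-t^3u)\,x_{3a+2b}(-t^3u^2)$ 2. $[x_{a}(u),x_{b}(t)]=x_{a+b}(tu)\,x_{2a+b}(-tu^2)\,x_{3a+b}(tu^3)\,x_{3a+2b}(-2t^2u^3)$ 3. $[x_{a+b}(u),x_{a}(t)]=x_{2a+b}(-2tu)\,x_{3a+b}(3t^2u)\,x_{3a+2b}(-3tu^2)$ 4. $[x_{2a+b}(u),x_{a}(t)]=x_{3a+b}(-3tu)$ 5. $[x_{3a+b}(u),x_{b}(t)]=x_{3a+2b}(-tu)$ 6. $[x_{2a+b}(u),x_{a+b}(t)]=x_{3a+2b}(3tu)$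 7. $[x_{-b}(u),x_{-a}(t)]=x_{-a-b}(tu)\,x_{-2a-b}(t^2u)\,x_{-3a-b}(t^3u)\,x_{-3a-2b}(-t^3u^2)$ 8. $[x_{-a}(u),x_{-b}(t)]=x_{-a-b}(-tu)\,x_{-2a-b}(-tu^2)\,x_{-3a-b}(-tu^3)\,x_{-3a-2b}(-2t^2u^3)$ 9. $[x_{-a-b}(u),x_{-a}(t)]=x_{-2a-b}(2tu)\,x_{-3a-b}(3t^2u)\,x_{-3a-2b}(-3tu^2)$ 10. $[x_{-2a-b}(u),x_{-a}(t)]=x_{-3a-b}(3tu)$ 11. $[x_{-3a-b}(u),x_{-b}(t)]=x_{-3a-2b}(tu)$ 12. $[x_{-2a-b}(u),x_{-a-b}(t)]=x_{-3a-2b}(-3tu)$ 13. $[x_{-a-b}(u),x_{a}(t)]=x_{-b}(3tu)$ 14. $[x_{-2a-b}(u),x_{a}(t)]=x_{-a-b}(2tu)\,x_{-b}(3t^2u)\,x_{-3a-2b}(3tu^2)$ 15. $[x_{-3a-b}(u),x_{a}(t)]=x_{-2a-b}(tu)\,x_{-a-b}(t^2u)\,x_{-b}(t^3u)\,x_{-3a-2b}(t^3u^2)$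 16. $[x_{a}(u),x_{-3a-b}(t)]=x_{-2a-b}(-tu)\,x_{-a-b}(-tu^2)\,x_{-b}(-tu^3)\,x_{-3a-2b}(2t^2u^3)$ 17. $[x_{b}(u),x_{-a-b}(t)]=x_{-a}(tu)\,x_{-2a-b}(-t^2u)\,x_{-3a-2b}(t^3u)\,x_{-3a-b}(-t^3u^2)$ 18. $[x_{-a-b}(u),x_{b}(t)]=x_{-a}(-tu)\,x_{-2a-b}(tu^2)\,x_{-3a-2b}(-tu^3)\,x_{-3a-b}(-2t^2u^3)$ 19. $[x_{-3a-2b}(u),x_{b}(t)]=x_{-3a-b}(tu)$ 20. $[x_{-a}(u),x_{a+b}(t)]=x_{b}(3tu)$ 21. $[x_{-b}(u),x_{a+b}(t)]=x_{a}(-tu)\,x_{2a+b}(-t^2u)\,x_{3a+2b}(-t^3u)\,x_{3a+b}(-t^3u^2)$ 22. $[x_{a+b}(u),x_{-b}(t)]=x_{a}(tu)\,x_{2a+b}(tu^2)\,x_{3a+2b}(tu^3)\,x_{3a+b}(-2t^2u^3)$ 23. $[x_{-2a-b}(u),x_{a+b}(t)]=x_{-a}(-2tu)\,x_{b}(-3t^2u)\,x_{-3a-b}(3tu^2)$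 24. $[x_{-3a-2b}(u),x_{a+b}(t)]=x_{-2a-b}(-tu)\,x_{-a}(t^2u)\,x_{b}(t^3u)\,x_{-3a-b}(t^3u^2)$ 25. $[x_{a+b}(u),x_{-3a-2b}(t)]=x_{-2a-b}(tu)\,x_{-a}(-tu^2)\,x_{b}(-tu^3)\,x_{-3a-b}(2t^2u^3)$ 26. $[x_{-a}(u),x_{2a+b}(t)]=x_{a+b}(2tu)\,x_{3a+2b}(-3t^2u)\,x_{b}(-3tu^2)$ 27. $[x_{-a-b}(u),x_{2a+b}(t)]=x_{a}(-2tu)\,x_{3a+b}(-3t^2u)\,x_{-b}(3tu^2)$ 28. $[x_{-3a-b}(u),x_{2a+b}(t)]=x_{-a}(-tu)\,x_{a+b}(-t^2u)\,x_{3a+2b}(t^3u)\,x_{b}(-t^3u^2)$ 29. $[x_{2a+b}(u),x_{-3a-b}(t)]=x_{-a}(tu)\,x_{a+b}(tu^2)\,x_{3a+2b}(-tu^3)\,x_{b}(-2t^2u^3)$ 30. $[x_{-3a-2b}(u),x_{2a+b}(t)]=x_{-a-b}(tu)\,x_{a}(-t^2u)\,x_{3a+b}(-t^3u)\,x_{-b}(t^3u^2)$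 31. $[x_{2a+b}(u),x_{-3a-2b}(t)]=x_{-a-b}(-tu)\,x_{a}(tu^2)\,x_{3a+b}(tu^3)\,x_{-b}(2t^2u^3)$ 32. $[x_{-a}(u),x_{3a+b}(t)]=x_{2a+b}(tu)\,x_{a+b}(-tu^2)\,x_{b}(tu^3)\,x_{3a+2b}(2t^2u^3)$ 33. $[x_{3a+b}(u),x_{-a}(t)]=x_{2a+b}(-tu)\,x_{a+b}(t^2u)\,x_{b}(-t^3u)\,x_{3a+2b}(t^3u^2)$ 34. $[x_{-2a-b}(u),x_{3a+b}(t)]=x_{a}(-tu)\,x_{-a-b}(tu^2)\,x_{-3a-2b}(tu^3)\,x_{-b}(-2t^2u^3)$ 35. $[x_{3a+b}(u),x_{-2a-b}(t)]=x_{a}(tu)\,x_{-a-b}(-t^2u)\,x_{-3a-2b}(-t^3u)\,x_{-b}(-t^3u^2)$ 36. $[x_{-3a-2b}(u),x_{3a+b}(t)]=x_{-b}(-tu)$ 37. $[x_{-a-b}(u),x_{3a+2b}(t)]=x_{2a+b}(-tu)\,x_{a}(-tu^2)\,x_{-b}(tu^3)\,x_{3a+b}(2t^2u^3)$ 38. $[x_{3a+2b}(u),x_{-a-b}(t)]=x_{2a+b}(tu)\,x_{a}(t^2u)\,x_{-b}(-t^3u)\,x_{3a+b}(t^3u^2)$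 39. $[x_{-2a-b}(u),x_{3a+2b}(t)]=x_{a+b}(tu)\,x_{-a}(tu^2)\,x_{-3a-b}(-tu^3)\,x_{b}(2t^2u^3)$ 40. $[x_{3a+2b}(u),x_{-2a-b}(t)]=x_{a+b}(-tu)\,x_{-a}(-t^2u)\,x_{-3a-b}(t^3u)\,x_{b}(t^3u^2)$ 41. $[x_{-3a-b}(u),x_{3a+2b}(t)]=x_{b}(-tu)$ -/

import Mathlib

open scoped TensorProduct

namespace G2

/-- The root system of type `G₂`, inside its root lattice: the pair `(m, n)` stands for
`m a + n b`, where `a = ε₁ - ε₂` (short) and `b = -2ε₁ + ε₂ + ε₃` (long) are the fundamental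
roots. -/
def roots : Finset (ℤ × ℤ) :=
  {(-3, -2), (-3, -1), (-2, -1), (-1, -1), (-1, 0), (0, -1),
   (1, 0), (0, 1), (1, 1), (2, 1), (3, 1), (3, 2)}

/-- The type of roots. -/
abbrev Root : Type := {r : ℤ × ℤ // r ∈ roots}

/-- The root `m a + n b`. -/
def rt (m n : ℤ) (h : (m, n) ∈ roots := by decide) : Root := ⟨(m, n), h⟩

theorem neg_mem_roots : ∀ r ∈ roots, -r ∈ roots := by decide

instance : Neg Root := ⟨fun r => ⟨-r.1, neg_mem_roots r.1 r.2⟩⟩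

/-- The Euclidean inner product on the root lattice:
`(a, a) = 2`, `(a, b) = -3`, `(b, b) = 6`. -/
def ip (r s : ℤ × ℤ) : ℤ :=
  2 * (r.1 * s.1) - 3 * (r.1 * s.2 + r.2 * s.1) + 6 * (r.2 * s.2)

/-- The Cartan integer `A_{rs} = 2 (r, s) / (r, r)` (the division is exact for roots). -/
def cartanInt (r s : Root) : ℤ := 2 * ip r.1 s.1 / ip r.1 r.1

/-- A Chevalley basis of a complex Lie algebra `L` of type `G₂`: root vectors `e r` for all roots
`r` and coroots `h r`, such that `h a`, `h b` and the `e r` form a basis of `L`, with the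
multiplication rules of a Chevalley basis and integral structure constants `N r s`. -/
structure ChevalleyBasis (L : Type*) [LieRing L] [LieAlgebra ℂ L] where
  /-- The coroots. -/
  h : Root → L
  /-- The root vectors. -/
  e : Root → L
  /-- The structure constants `N_{r,s}` (meaningful when `r + s` is a root). -/
  N : Root → Root → ℤ
  linearIndependent : LinearIndependent ℂ (Sum.elim ![h (rt 1 0), h (rt 0 1)] e)
  span_eq_top : Submodule.span ℂ (Set.range (Sum.elim ![h (rt 1 0), h (rt 0 1)] e)) = ⊤
  /-- `h r` corresponds to `2 r / (r, r)`: for `r = m a + n b` one has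
  `(r, r) h_r = m (a, a) h_a + n (b, b) h_b`. -/
  ip_smul_h : ∀ r : Root, ip r.1 r.1 • h r =
    (r.1.1 * ip (1, 0) (1, 0)) • h (rt 1 0) + (r.1.2 * ip (0, 1) (0, 1)) • h (rt 0 1)
  lie_h_h : ∀ r s : Root, ⁅h r, h s⁆ = 0
  lie_h_e : ∀ r s : Root, ⁅h r, e s⁆ = cartanInt r s • e s
  lie_e_neg : ∀ r : Root, ⁅e r, e (-r)⁆ = h r
  lie_e_e_eq_zero : ∀ r s : Root, r.1 + s.1 ≠ 0 → r.1 + s.1 ∉ roots → ⁅e r, e s⁆ = 0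
  lie_e_e : ∀ r s q : Root, r.1 + s.1 = q.1 → ⁅e r, e s⁆ = N r s • e q
  /-- `N_{r,s} = ±(p + 1)`, where `s - p r, …, s` is the descending part of the `r`-string
  through `s`. -/
  N_eq : ∀ r s : Root, r.1 + s.1 ∈ roots → ∀ p : ℕ, (∀ i : ℕ, i ≤ p → s.1 - i • r.1 ∈ roots) →
    s.1 - (p + 1) • r.1 ∉ roots → N r s = p + 1 ∨ N r s = -(p + 1)

/-- The number `p` such that `s - p r, …, s` is the descending part of the `r`-string. -/
def strLen (r s : Root) : ℕ := Nat.findGreatest (fun p => s.1 - p • r.1 ∈ roots) 3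

theorem strLen_le (r s : Root) : strLen r s ≤ 3 := Nat.findGreatest_le 3

theorem string_step : ∀ r s : Root, s ≠ r → s ≠ -r →
    r.1 + s.1 ≠ 0 ∧ (∀ i : ℕ, i ≤ strLen r s → s.1 - i • r.1 ∈ roots) ∧
    s.1 - (strLen r s + 1) • r.1 ∉ roots ∧
    ∀ q : Root, r.1 + s.1 = q.1 → q ≠ r ∧ q ≠ -r ∧ strLen r q = strLen r s + 1 := by
  decide +kernel

theorem coroot_coeff : ∀ r : Root, ip r.1 r.1 ≠ 0 ∧
    ip r.1 r.1 * (r.1.1 * ip (1, 0) (1, 0) / ip r.1 r.1) = r.1.1 * ip (1, 0) (1, 0) ∧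
    ip r.1 r.1 * (r.1.2 * ip (0, 1) (0, 1) / ip r.1 r.1) = r.1.2 * ip (0, 1) (0, 1) := by
  decide +kernel

theorem cartanInt_self : ∀ r : Root, cartanInt r r = 2 := by decide +kernel

namespace ChevalleyBasis

noncomputable section

variable {L : Type*} [LieRing L] [LieAlgebra ℂ L] (C : ChevalleyBasis L)

/-- The integral form `L_ℤ` of `L`: the `ℤ`-span of the Chevalley basis. -/
def lattice : Submodule ℤ L :=
  Submodule.span ℤ (Set.range (Sum.elim ![C.h (rt 1 0), C.h (rt 0 1)] C.e))

/-- The divided power `(ad e_r)^i / i!` on `L`. -/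
def divPow (r : Root) (i : ℕ) : Module.End ℂ L :=
  (i.factorial : ℂ)⁻¹ • (LieAlgebra.ad ℂ L (C.e r)) ^ i

theorem e_mem (r : Root) : C.e r ∈ C.lattice := Submodule.subset_span ⟨Sum.inr r, rfl⟩

theorem h_mem (r : Root) : C.h r ∈ C.lattice := by
  have ha : C.h (rt 1 0) ∈ C.lattice := Submodule.subset_span ⟨Sum.inl 0, rfl⟩
  have hb : C.h (rt 0 1) ∈ C.lattice := Submodule.subset_span ⟨Sum.inl 1, rfl⟩
  obtain ⟨h0, h1, h2⟩ := coroot_coeff r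
  have key : C.h r = (r.1.1 * ip (1, 0) (1, 0) / ip r.1 r.1) • C.h (rt 1 0) +
      (r.1.2 * ip (0, 1) (0, 1) / ip r.1 r.1) • C.h (rt 0 1) := by
    have h3 := C.ip_smul_h r
    rw [← h1, ← h2, mul_smul, mul_smul, ← smul_add] at h3
    have h4 : ((ip r.1 r.1 : ℤ) : ℂ) ≠ 0 := by exact_mod_cast h0
    rw [← Int.cast_smul_eq_zsmul ℂ, ← Int.cast_smul_eq_zsmul ℂ] at h3
    exact smul_right_injective L h4 h3
  rw [key]
  exact add_mem (Submodule.smul_mem _ _ ha) (Submodule.smul_mem _ _ hb)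

theorem divPow_zero (r : Root) : C.divPow r 0 = 1 := by simp [divPow]

theorem divPow_succ (r : Root) (i : ℕ) (v : L) :
    C.divPow r (i + 1) v = ((i : ℂ) + 1)⁻¹ • ⁅C.e r, C.divPow r i v⁆ := by
  simp only [divPow, LinearMap.smul_apply, pow_succ', Module.End.mul_apply, LieAlgebra.ad_apply,
    lie_smul, smul_smul, Nat.factorial_succ, Nat.cast_mul, Nat.cast_add, Nat.cast_one, mul_inv]

theorem divPow_mul (r : Root) (i j : ℕ) :
    C.divPow r i * C.divPow r j = ((i + j).choose i : ℂ) • C.divPow r (i + j) := by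
  simp only [divPow, smul_mul_smul_comm, ← pow_add, smul_smul]
  congr 1
  rw [Nat.cast_add_choose]
  have hi : ((i + j).factorial : ℂ) ≠ 0 := by exact_mod_cast (i + j).factorial_ne_zero
  field_simp

/-- Divided powers on the part of the basis off the line through `r`. -/
theorem divPow_e (r s : Root) (h1 : s ≠ r) (h2 : s ≠ -r) (i : ℕ) :
    C.divPow r i (C.e s) = 0 ∨ ∃ q : Root, q ≠ r ∧ q ≠ -r ∧ strLen r q = strLen r s + i ∧
      ∃ n : ℤ, (n = (strLen r s + i).choose i ∨ n = -((strLen r s + i).choose i : ℤ)) ∧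
        C.divPow r i (C.e s) = n • C.e q := by
  induction i with
  | zero => exact Or.inr ⟨s, h1, h2, rfl, 1, by simp, by simp [divPow_zero]⟩
  | succ i ih =>
    rcases ih with h | ⟨q, hq1, hq2, hq3, n, hn, hv⟩
    · left; rw [divPow_succ, h, lie_zero, smul_zero]
    · obtain ⟨g1, g2, g3, g4⟩ := string_step r q hq1 hq2
      by_cases hr : r.1 + q.1 ∈ roots
      · right
        obtain ⟨k1, k2, k3⟩ := g4 ⟨_, hr⟩ rfl
        refine ⟨⟨_, hr⟩, k1, k2, by omega, ?_⟩
        have hN := C.N_eq r q hr _ g2 g3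
        rw [hq3] at hN
        have hc := Nat.add_one_mul_choose_eq (strLen r s + i) i
        rw [divPow_succ, hv, lie_zsmul, C.lie_e_e r q ⟨_, hr⟩ rfl]
        have hi : ((i : ℂ) + 1) ≠ 0 := by exact_mod_cast i.succ_ne_zero
        have main : ∀ m : ℤ, n * C.N r q = (i + 1) * m →
            ((i : ℂ) + 1)⁻¹ • n • C.N r q • C.e ⟨_, hr⟩ = m • C.e ⟨_, hr⟩ := by
          intro m hm
          rw [smul_smul n, hm, mul_smul, ← Int.cast_smul_eq_zsmul ℂ (((i : ℤ) + 1)), smul_smul]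
          push_cast
          rw [inv_mul_cancel₀ hi, one_smul]
        have hc' : ((strLen r s : ℤ) + i + 1) * ((strLen r s + i).choose i : ℤ) =
            ((strLen r s + (i + 1)).choose (i + 1) : ℤ) * (i + 1) := by
          exact_mod_cast hc
        push_cast at hN
        rcases hn with hn | hn <;> rcases hN with hN | hN
        · exact ⟨_, Or.inl rfl, main _ (by rw [hn, hN]; linear_combination hc')⟩
        · exact ⟨_, Or.inr rfl, main _ (by rw [hn, hN]; linear_combination -hc')⟩
        · exact ⟨_, Or.inr rfl, main _ (by rw [hn, hN]; linear_combination -hc')⟩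
        · exact ⟨_, Or.inl rfl, main _ (by rw [hn, hN]; linear_combination hc')⟩
      · left
        rw [divPow_succ, hv, lie_zsmul, C.lie_e_e_eq_zero r q g1 hr, smul_zero, smul_zero]

theorem divPow_eq_zero_of_le (r : Root) (v : L) {i j : ℕ} (hij : i ≤ j)
    (h : C.divPow r i v = 0) : C.divPow r j v = 0 := by
  induction j, hij using Nat.le_induction with
  | base => exact h
  | succ j _ ih => rw [divPow_succ, ih, lie_zero, smul_zero]

theorem divPow_h (r s : Root) :
    C.divPow r 1 (C.h s) ∈ C.lattice ∧ C.divPow r 2 (C.h s) = 0 := by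
  have h1 : C.divPow r 1 (C.h s) = -(cartanInt s r • C.e r) := by
    rw [divPow_succ, divPow_zero, Module.End.one_apply, ← lie_skew, C.lie_h_e]; simp
  refine ⟨?_, ?_⟩
  · rw [h1]; exact neg_mem (Submodule.smul_mem _ _ (C.e_mem r))
  · rw [divPow_succ, h1]; simp

theorem divPow_neg (r : Root) : C.divPow r 1 (C.e (-r)) ∈ C.lattice ∧
    C.divPow r 2 (C.e (-r)) ∈ C.lattice ∧ C.divPow r 3 (C.e (-r)) = 0 := by
  have h1 : C.divPow r 1 (C.e (-r)) = C.h r := by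
    rw [divPow_succ, divPow_zero, Module.End.one_apply, C.lie_e_neg]; simp
  have h2 : C.divPow r 2 (C.e (-r)) = -C.e r := by
    rw [divPow_succ, h1, ← lie_skew, C.lie_h_e, cartanInt_self,
      ← Int.cast_smul_eq_zsmul ℂ, smul_neg, smul_smul]
    norm_num
  refine ⟨h1 ▸ C.h_mem r, h2 ▸ neg_mem (C.e_mem r), ?_⟩
  rw [divPow_succ, h2]; simp

theorem divPow_gen (r : Root) (g : Fin 2 ⊕ Root) :
    (∀ i, C.divPow r i (Sum.elim ![C.h (rt 1 0), C.h (rt 0 1)] C.e g) ∈ C.lattice) ∧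
      C.divPow r 4 (Sum.elim ![C.h (rt 1 0), C.h (rt 0 1)] C.e g) = 0 := by
  have hh : ∀ s, (∀ i, C.divPow r i (C.h s) ∈ C.lattice) ∧ C.divPow r 4 (C.h s) = 0 := by
    intro s
    obtain ⟨k1, k2⟩ := C.divPow_h r s
    refine ⟨fun i => ?_, C.divPow_eq_zero_of_le r _ (by norm_num) k2⟩
    match i with
    | 0 => simpa [divPow_zero] using C.h_mem s
    | 1 => exact k1
    | i + 2 => rw [C.divPow_eq_zero_of_le r _ (by omega) k2]; exact zero_mem _
  rcases g with g | s
  · fin_cases g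
    · exact hh _
    · exact hh _
  · change (∀ i, C.divPow r i (C.e s) ∈ C.lattice) ∧ C.divPow r 4 (C.e s) = 0
    by_cases h1 : s = r
    · subst h1
      have k : C.divPow s 1 (C.e s) = 0 := by
        rw [divPow_succ, divPow_zero, Module.End.one_apply, lie_self, smul_zero]
      refine ⟨fun i => ?_, C.divPow_eq_zero_of_le s _ (by norm_num) k⟩
      match i with
      | 0 => simpa [divPow_zero] using C.e_mem s
      | i + 1 => rw [C.divPow_eq_zero_of_le s _ (by omega) k]; exact zero_mem _
    · by_cases h2 : s = -r
      · subst h2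
        obtain ⟨k1, k2, k3⟩ := C.divPow_neg r
        refine ⟨fun i => ?_, C.divPow_eq_zero_of_le r _ (by norm_num) k3⟩
        match i with
        | 0 => simpa [divPow_zero] using C.e_mem (-r)
        | 1 => exact k1
        | 2 => exact k2
        | i + 3 => rw [C.divPow_eq_zero_of_le r _ (by omega) k3]; exact zero_mem _
      · refine ⟨fun i => ?_, ?_⟩
        · rcases C.divPow_e r s h1 h2 i with h | ⟨q, -, -, -, n, -, h⟩
          · rw [h]; exact zero_mem _
          · rw [h]; exact Submodule.smul_mem _ _ (C.e_mem q)
        · rcases C.divPow_e r s h1 h2 4 with h | ⟨q, -, -, h, -⟩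
          · exact h
          · have := strLen_le r q; omega

theorem divPow_mem (r : Root) (i : ℕ) :
    ∀ v ∈ C.lattice, (C.divPow r i).restrictScalars ℤ v ∈ C.lattice := by
  intro v hv
  have : C.lattice ≤ C.lattice.comap ((C.divPow r i).restrictScalars ℤ) := by
    conv_lhs => rw [lattice]
    rw [Submodule.span_le]
    rintro _ ⟨g, rfl⟩
    exact (C.divPow_gen r g).1 i
  exact this hv

theorem divPow_four (r : Root) : C.divPow r 4 = 0 := by
  refine LinearMap.ext_on_range C.span_eq_top fun g => ?_
  exact (C.divPow_gen r g).2

/-- The divided power `(ad e_r)^i / i!` on the integral form `L_ℤ`. -/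
def intDivPow (r : Root) (i : ℕ) : Module.End ℤ C.lattice :=
  ((C.divPow r i).restrictScalars ℤ).restrict (C.divPow_mem r i)

theorem intDivPow_zero (r : Root) : C.intDivPow r 0 = 1 := by
  ext v; simp [intDivPow, divPow_zero]

theorem intDivPow_of_le (r : Root) (i : ℕ) (hi : 4 ≤ i) : C.intDivPow r i = 0 := by
  ext v
  simp [intDivPow, C.divPow_eq_zero_of_le r v hi (by simp [divPow_four])]

theorem intDivPow_mul (r : Root) (i j : ℕ) :
    C.intDivPow r i * C.intDivPow r j = (i + j).choose i • C.intDivPow r (i + j) := by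
  ext v
  have := LinearMap.congr_fun (C.divPow_mul r i j) (v : L)
  rw [LinearMap.smul_apply, Nat.cast_smul_eq_nsmul] at this
  simpa [intDivPow] using this

variable (K : Type*) [CommRing K]

/-- The Lie algebra (as a module) `L_K = K ⊗ L_ℤ` over `K`. -/
abbrev Form : Type _ := K ⊗[ℤ] C.lattice

variable {K}

/-- The endomorphism `exp (t ad e_r) = ∑ tⁱ (ad e_r)ⁱ / i!` of `L_K`
(`(ad e_r)⁴ = 0`, so that the sum stops at `i = 3`). -/
def rootEnd (r : Root) (t : K) : Module.End K (C.Form K) :=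
  ∑ i ∈ Finset.range 4, t ^ i • (C.intDivPow r i).baseChange K

theorem rootEnd_zero (r : Root) : C.rootEnd r (0 : K) = 1 := by
  simp [rootEnd, Finset.sum_range_succ, intDivPow_zero, Module.End.one_eq_id]

theorem rootEnd_mul (r : Root) (t u : K) :
    C.rootEnd r t * C.rootEnd r u = C.rootEnd r (t + u) := by
  have key : ∀ i j : ℕ, (C.intDivPow r i).baseChange K * (C.intDivPow r j).baseChange K =
      ((i + j).choose i : K) • (C.intDivPow r (i + j)).baseChange K := by
    intro i j
    have h : (C.intDivPow r i * C.intDivPow r j).baseChange K =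
        (C.intDivPow r i).baseChange K * (C.intDivPow r j).baseChange K :=
      LinearMap.baseChange_comp ..
    rw [← h, intDivPow_mul]
    ext v
    simp [TensorProduct.smul_tmul', TensorProduct.tmul_smul, Nat.cast_smul_eq_nsmul]
  have h0 : ∀ i, 4 ≤ i → (C.intDivPow r i).baseChange K = 0 := by
    intro i hi
    rw [C.intDivPow_of_le r i hi, LinearMap.baseChange_zero]
  simp only [rootEnd, Finset.sum_range_succ, Finset.sum_range_zero, zero_add, add_mul, mul_add,
    smul_mul_smul_comm, key, h0 4 (by norm_num), h0 5 (by norm_num), h0 6 (by norm_num),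
    Nat.reduceAdd, smul_zero, add_zero, smul_smul]
  norm_num [Nat.choose]
  module

/-- The root element `x_r(t) = exp (t ad e_r)` as an automorphism of `L_K`. -/
def rootAut (r : Root) (t : K) : C.Form K ≃ₗ[K] C.Form K :=
  LinearEquiv.ofLinearMap (C.rootEnd r t) (C.rootEnd r (-t))
    (by rw [← Module.End.mul_eq_comp, rootEnd_mul, add_neg_cancel, rootEnd_zero]; rfl)
    (by rw [← Module.End.mul_eq_comp, rootEnd_mul, neg_add_cancel, rootEnd_zero]; rfl)

variable (K) in
/-- The Chevalley group of type `G₂` over `K`: the group of automorphisms of `L_K` generated by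
all root elements. -/
def chevalleyGroup : Subgroup (C.Form K ≃ₗ[K] C.Form K) :=
  Subgroup.closure {g | ∃ (r : Root) (t : K), g = C.rootAut r t}

/-- The root element `x_r(t)` of the Chevalley group, for the root `r = m a + n b`. -/
def x (m n : ℤ) (t : K) (h : (m, n) ∈ roots := by decide) : C.chevalleyGroup K :=
  ⟨C.rootAut (rt m n h) t, Subgroup.subset_closure ⟨rt m n h, t, rfl⟩⟩

end

end ChevalleyBasis

/-- The commutator `[g, h] = g⁻¹ h⁻¹ g h`. -/
def comm {G : Type*} [Group G] (g h : G) : G := g⁻¹ * h⁻¹ * g * h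

end G2

open G2

/-!
Over a `ℚ`-algebra, conjugating `x_s(u) = exp (u ad e_s)` by `x_r(t)` replaces `u ad e_s` by its
image under `exp (-t ad (ad e_r))`, a sum of operators `ad e_{ir+s}` whose coefficients are Carter's
constants `M_{r,s,i}`. The exponential of this sum splits into root elements by the
Baker–Campbell–Hausdorff formula for `a` and `b` commuting with `[a, b]`: the polynomial path
`f(X) = exp (aX) exp (bX) exp (-[a, b]X² / 2)` satisfies `f(0) = 1` and `f' = f · (a + b)`, hence
`f(1) = exp (a + b)`. Both sides of the resulting formula are polynomial in `t` and `u` and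
`ℤ[t, u] ⊆ ℚ[t, u]`, so it holds over every commutative ring. If `r + 3s` is a root, the sum does
not split in this way; then `2r + s` is not a root, so one inverts `[x_r(t), x_s(u)]` and reverses
the order of its factors instead.

By the Jacobi identity `N_{r,s} / (q, q) = N_{s,q} / (r, r)` if `r + s + q = 0`, and
`N_{r,s} N_{-r,r+s} > 0`. These two rules propagate the signs from the extraspecial pairs to all
pairs of roots.
-/

namespace G2

attribute [local instance] LieRing.ofAssociativeRing

section NilpotentExp

open Polynomial

variable {A : Type*} [Ring A]

theorem derivative_pow_succ_of_commute {f : A[X]} (h : Commute f (derivative f)) (n : ℕ) :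
    derivative (f ^ (n + 1)) = (n + 1) • (f ^ n * derivative f) := by
  induction n with
  | zero => simp
  | succ n ih =>
    rw [pow_succ, derivative_mul, ih, smul_mul_assoc, mul_assoc, ← h.eq, ← mul_assoc, ← pow_succ,
      ← succ_nsmul]

theorem isNilpotent_C_mul_X_pow {a : A} (ha : IsNilpotent a) (n : ℕ) :
    IsNilpotent (C a * X ^ n : A[X]) :=
  (commute_X_pow _ n).symm.isNilpotent_mul_right (ha.map C)

variable [Algebra ℚ A]

theorem derivative_exp_of_commute {f : A[X]} (hf : IsNilpotent f)
    (h : Commute f (derivative f)) :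
    derivative (IsNilpotent.exp f) = IsNilpotent.exp f * derivative f := by
  obtain ⟨k, hk⟩ := hf
  have term (i : ℕ) : derivative (((i + 1).factorial : ℚ)⁻¹ • f ^ (i + 1)) =
      (i.factorial : ℚ)⁻¹ • f ^ i * derivative f := by
    rw [derivative_smul, derivative_pow_succ_of_commute h, ← Nat.cast_smul_eq_nsmul ℚ, smul_smul,
      smul_mul_assoc, Nat.factorial_succ]
    congr 1
    push_cast
    field_simp
  conv_lhs => rw [IsNilpotent.exp_eq_sum (pow_eq_zero_of_le k.le_succ hk)]
  rw [Finset.sum_range_succ', derivative_add, derivative_sum,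
    Finset.sum_congr rfl fun i _ => term i, ← Finset.sum_mul, ← IsNilpotent.exp_eq_sum hk]
  simp

theorem factorial_smul_coeff_of_derivative_eq_mul_C {f : A[X]} {a : A} (h0 : f.coeff 0 = 1)
    (h : derivative f = f * C a) (n : ℕ) : (n.factorial : ℚ) • f.coeff n = a ^ n := by
  induction n with
  | zero => simp [h0]
  | succ n ih =>
    have hn : f.coeff (n + 1) * (n + 1) = f.coeff n * a := by
      rw [← coeff_derivative, h, coeff_mul_C]
    rw [pow_succ, ← ih, smul_mul_assoc, ← hn, Nat.factorial_succ, mul_comm, Nat.cast_mul, mul_smul]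
    congr 1
    rw [Nat.cast_smul_eq_nsmul, nsmul_eq_mul']
    push_cast
    rfl

theorem pow_natDegree_succ_eq_zero_of_derivative_eq_mul_C {f : A[X]} {a : A} (h0 : f.coeff 0 = 1)
    (h : derivative f = f * C a) : a ^ (f.natDegree + 1) = 0 := by
  rw [← factorial_smul_coeff_of_derivative_eq_mul_C h0 h,
    coeff_eq_zero_of_natDegree_lt f.natDegree.lt_succ_self, smul_zero]

theorem eval_one_eq_exp_of_derivative_eq_mul_C {f : A[X]} {a : A} (h0 : f.coeff 0 = 1)
    (h : derivative f = f * C a) : f.eval 1 = IsNilpotent.exp a := by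
  rw [IsNilpotent.exp_eq_sum (pow_natDegree_succ_eq_zero_of_derivative_eq_mul_C h0 h),
    eval_eq_sum_range]
  refine Finset.sum_congr rfl fun i _ => ?_
  rw [← factorial_smul_coeff_of_derivative_eq_mul_C h0 h,
    inv_smul_smul₀ (Nat.cast_ne_zero.2 i.factorial_ne_zero), one_pow, mul_one]

theorem exp_mul_mul_exp_neg {a : A} (ha : IsNilpotent a) (b : A) :
    IsNilpotent.exp a * b * IsNilpotent.exp (-a) = IsNilpotent.exp (LieAlgebra.ad ℚ A a) b := by
  have hl : IsNilpotent (LinearMap.mulLeft ℚ a) := (LinearMap.isNilpotent_mulLeft_iff ℚ a).2 ha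
  have hr : IsNilpotent (LinearMap.mulRight ℚ (-a)) :=
    (LinearMap.isNilpotent_mulRight_iff ℚ (-a)).2 ha.neg
  have had : LieAlgebra.ad ℚ A a = LinearMap.mulLeft ℚ a + LinearMap.mulRight ℚ (-a) := by
    ext c; simp [Ring.lie_def, sub_eq_add_neg]
  obtain ⟨k, hk⟩ := ha
  have hk' : (-a) ^ k = 0 := by rw [neg_pow, hk, mul_zero]
  rw [had, IsNilpotent.exp_add_of_commute (LinearMap.commute_mulLeft_right a (-a)) hl hr,
    IsNilpotent.exp_eq_sum hk, IsNilpotent.exp_eq_sum hk',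
    IsNilpotent.exp_eq_sum (a := LinearMap.mulLeft ℚ a) (k := k)
      (by simp [LinearMap.pow_mulLeft, hk]),
    IsNilpotent.exp_eq_sum (a := LinearMap.mulRight ℚ (-a)) (k := k)
      (by simp [LinearMap.pow_mulRight, hk'])]
  simp [LinearMap.pow_mulLeft, LinearMap.pow_mulRight, Finset.mul_sum, Finset.sum_mul, mul_assoc]

theorem exp_mul_exp_mul_exp_neg {a b : A} (ha : IsNilpotent a) (hb : IsNilpotent b) :
    IsNilpotent.exp a * IsNilpotent.exp b * IsNilpotent.exp (-a) =
      IsNilpotent.exp (IsNilpotent.exp (LieAlgebra.ad ℚ A a) b) := by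
  let g : Aˣ := ⟨IsNilpotent.exp a, IsNilpotent.exp (-a), IsNilpotent.exp_mul_exp_neg_self ha,
    IsNilpotent.exp_neg_mul_exp_self ha⟩
  have h := IsNilpotent.exp_smul (ConjAct.toConjAct g) hb
  rw [ConjAct.units_smul_def, ConjAct.units_smul_def] at h
  rw [← exp_mul_mul_exp_neg ha b]
  exact h.symm

theorem exp_ad_of_commute_lie {a b : A} (ha : IsNilpotent a) (h : Commute a ⁅a, b⁆) :
    IsNilpotent.exp (LieAlgebra.ad ℚ A a) b = b + ⁅a, b⁆ := by
  have h2 : (LieAlgebra.ad ℚ A a) ^ 2 • b = 0 := by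
    simpa [pow_two] using (commute_iff_lie_eq.1 h)
  rw [← Module.End.smul_def,
    IsNilpotent.exp_smul_eq_sum h2 (LieAlgebra.ad_nilpotent_of_nilpotent ha)]
  simp [Finset.sum_range_succ]

theorem mul_exp_of_commute_lie {a b : A} (ha : IsNilpotent a) (h : Commute a ⁅a, b⁆) :
    b * IsNilpotent.exp a = IsNilpotent.exp a * (b - ⁅a, b⁆) := by
  have hneg := exp_ad_of_commute_lie (b := b) ha.neg (by rw [neg_lie]; exact h.neg_left.neg_right)
  rw [← exp_mul_mul_exp_neg ha.neg, neg_neg, neg_lie, ← sub_eq_add_neg] at hneg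
  rw [← hneg, ← mul_assoc, ← mul_assoc, IsNilpotent.exp_mul_exp_neg_self ha, one_mul]

theorem commute_exp {a b : A} (ha : IsNilpotent a) (h : Commute b a) :
    Commute b (IsNilpotent.exp a) := by
  have h0 : ⁅a, b⁆ = 0 := commute_iff_lie_eq.1 h.symm
  have hmul := mul_exp_of_commute_lie (b := b) ha (by rw [h0]; exact Commute.zero_right a)
  rwa [h0, sub_zero] at hmul

theorem coeff_zero_exp {f : A[X]} (hf : IsNilpotent f) (h0 : f.coeff 0 = 0) :
    (IsNilpotent.exp f).coeff 0 = 1 := by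
  rw [← constantCoeff_apply, IsNilpotent.map_exp hf, constantCoeff_apply, h0, IsNilpotent.exp_zero]

theorem derivative_exp_C_mul_X_pow {a : A} (ha : IsNilpotent a) (n : ℕ) :
    derivative (IsNilpotent.exp (C a * X ^ n)) =
      IsNilpotent.exp (C a * X ^ n) * (C (a * n) * X ^ (n - 1)) := by
  rw [derivative_exp_of_commute (isNilpotent_C_mul_X_pow ha n), derivative_C_mul_X_pow]
  rw [derivative_C_mul_X_pow]
  exact .mul_left (.mul_right (.map (.mul_right (.refl a) (Nat.cast_commute n a).symm) C)
    (commute_X_pow _ _).symm) (commute_X_pow _ _)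

theorem C_mul_exp_C_mul_X {a b : A} (hb : IsNilpotent b) (h : Commute b ⁅a, b⁆) :
    C a * IsNilpotent.exp (C b * X ^ 1) =
      IsNilpotent.exp (C b * X ^ 1) * (C a + C ⁅a, b⁆ * X) := by
  have hlie : ⁅C b * X ^ 1, C a⁆ = -(C ⁅a, b⁆ * X) := by
    simp only [pow_one, Ring.lie_def, mul_assoc, X_mul_C, C_sub, C_mul, sub_mul, neg_sub]
  rw [mul_exp_of_commute_lie (isNilpotent_C_mul_X_pow hb 1), hlie, sub_neg_eq_add]
  rw [hlie, pow_one]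
  exact .neg_right (.mul_left (.mul_right (h.map C) (commute_X _).symm) (commute_X _))

/-- The polynomial path `exp (aX) exp (bX) exp (-[a, b]X² / 2)`, whose value at `1` is the right
hand side of the Baker–Campbell–Hausdorff formula for `a` and `b` commuting with `[a, b]`. -/
noncomputable def bchPath (a b : A) : A[X] :=
  IsNilpotent.exp (C a * X ^ 1) * IsNilpotent.exp (C b * X ^ 1) *
    IsNilpotent.exp (C (-(2⁻¹ : ℚ) • ⁅a, b⁆) * X ^ 2)

section BCH

variable {a b : A}

theorem coeff_zero_bchPath (ha : IsNilpotent a) (hb : IsNilpotent b) (hab : IsNilpotent ⁅a, b⁆) :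
    (bchPath a b).coeff 0 = 1 := by
  rw [bchPath, mul_coeff_zero, mul_coeff_zero,
    coeff_zero_exp (isNilpotent_C_mul_X_pow ha 1) (by simp),
    coeff_zero_exp (isNilpotent_C_mul_X_pow hb 1) (by simp),
    coeff_zero_exp (isNilpotent_C_mul_X_pow (hab.smul _) 2) (by simp), one_mul, one_mul]

theorem eval_one_bchPath (ha : IsNilpotent a) (hb : IsNilpotent b) (hab : IsNilpotent ⁅a, b⁆) :
    (bchPath a b).eval 1 =
      IsNilpotent.exp a * IsNilpotent.exp b * IsNilpotent.exp (-(2⁻¹ : ℚ) • ⁅a, b⁆) := by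
  let ev := eval₂RingHom' (RingHom.id A) 1 fun a => Commute.one_right a
  change ev _ = _
  rw [bchPath, map_mul, map_mul, IsNilpotent.map_exp (isNilpotent_C_mul_X_pow ha 1),
    IsNilpotent.map_exp (isNilpotent_C_mul_X_pow hb 1),
    IsNilpotent.map_exp (isNilpotent_C_mul_X_pow (hab.smul _) 2)]
  simp [ev]

theorem derivative_bchPath (ha : IsNilpotent a) (hb : IsNilpotent b) (hab : IsNilpotent ⁅a, b⁆)
    (h₁ : Commute a ⁅a, b⁆) (h₂ : Commute b ⁅a, b⁆) :
    derivative (bchPath a b) = bchPath a b * C (a + b) := by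
  have hswap := C_mul_exp_C_mul_X hb h₂
  have hcentral {c : A} (h : Commute c ⁅a, b⁆) :
      Commute (C c) (IsNilpotent.exp (C (-(2⁻¹ : ℚ) • ⁅a, b⁆) * X ^ 2)) :=
    commute_exp (isNilpotent_C_mul_X_pow (hab.smul _) 2)
      (.mul_right ((h.smul_right _).map C) (commute_X_pow _ _).symm)
  have hX : Commute X (IsNilpotent.exp (C (-(2⁻¹ : ℚ) • ⁅a, b⁆) * X ^ 2)) := commute_X _
  have hhalf : -(2⁻¹ : ℚ) • ⁅a, b⁆ * (2 : ℕ) = -⁅a, b⁆ := by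
    rw [← nsmul_eq_mul', ← Nat.cast_smul_eq_nsmul ℚ, smul_smul]
    norm_num
  rw [bchPath, derivative_mul, derivative_mul, derivative_exp_C_mul_X_pow ha,
    derivative_exp_C_mul_X_pow hb, derivative_exp_C_mul_X_pow (hab.smul _), hhalf]
  simp only [Nat.cast_one, mul_one, Nat.sub_self, pow_zero, C_neg, neg_mul, C_add]
  generalize IsNilpotent.exp (C a * X ^ 1) = u at *
  generalize IsNilpotent.exp (C b * X ^ 1) = v at *
  generalize IsNilpotent.exp (C (-(2⁻¹ : ℚ) • ⁅a, b⁆) * X ^ 2) = w at *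
  have ha' := (hcentral h₁).eq
  have hb' := (hcentral h₂).eq
  have hz' := ((hcentral (.refl _)).mul_left hX).eq
  calc (u * C a * v + u * (v * C b)) * w + u * v * (w * -(C ⁅a, b⁆ * X ^ (2 - 1)))
    _ = u * (C a * v) * w + u * v * (C b * w) - u * v * (w * (C ⁅a, b⁆ * X)) := by
      noncomm_ring
    _ = u * v * (C a * w) + u * v * (C b * w) := by rw [hswap, ← hz']; noncomm_ring
    _ = u * v * w * (C a + C b) := by rw [ha', hb']; noncomm_ring

theorem isNilpotent_add_of_commute_lie (ha : IsNilpotent a) (hb : IsNilpotent b)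
    (hab : IsNilpotent ⁅a, b⁆) (h₁ : Commute a ⁅a, b⁆) (h₂ : Commute b ⁅a, b⁆) :
    IsNilpotent (a + b) :=
  ⟨_, pow_natDegree_succ_eq_zero_of_derivative_eq_mul_C (coeff_zero_bchPath ha hb hab)
    (derivative_bchPath ha hb hab h₁ h₂)⟩

theorem exp_add_of_commute_lie (ha : IsNilpotent a) (hb : IsNilpotent b)
    (hab : IsNilpotent ⁅a, b⁆) (h₁ : Commute a ⁅a, b⁆) (h₂ : Commute b ⁅a, b⁆) :
    IsNilpotent.exp (a + b) =
      IsNilpotent.exp a * IsNilpotent.exp b * IsNilpotent.exp (-(2⁻¹ : ℚ) • ⁅a, b⁆) := by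
  rw [← eval_one_bchPath ha hb hab, eval_one_eq_exp_of_derivative_eq_mul_C
    (coeff_zero_bchPath ha hb hab) (derivative_bchPath ha hb hab h₁ h₂)]

end BCH

theorem exp_add_add_add_of_lie {p q₁ q₂ q₃ y z : A}
    (hp : IsNilpotent p) (hq₁ : IsNilpotent q₁) (hq₂ : IsNilpotent q₂) (hq₃ : IsNilpotent q₃)
    (hy : IsNilpotent y) (hz : IsNilpotent z)
    (hpq₁ : ⁅p, q₁⁆ = -(2 • y)) (hpq₂ : ⁅p, q₂⁆ = 0) (hpq₃ : ⁅p, q₃⁆ = z)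
    (hq₁q₂ : ⁅q₁, q₂⁆ = -(3 • z)) (hq₁q₃ : ⁅q₁, q₃⁆ = 0) (hq₂q₃ : Commute q₂ q₃)
    (hcy : ∀ a ∈ [p, q₁, q₂, q₃], Commute a y) (hcz : ∀ a ∈ [p, q₁, q₂, q₃, y], Commute a z) :
    IsNilpotent.exp (p + (q₁ + (q₂ + q₃))) =
      IsNilpotent.exp p * IsNilpotent.exp q₁ * IsNilpotent.exp q₂ * IsNilpotent.exp q₃ *
        IsNilpotent.exp y * IsNilpotent.exp z := by
  simp only [List.forall_mem_cons, List.not_mem_nil, false_implies, implies_true, and_true]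
    at hcy hcz
  obtain ⟨hpy, hq₁y, hq₂y, hq₃y⟩ := hcy
  obtain ⟨hpz, hq₁z, hq₂z, hq₃z, hyz⟩ := hcz
  have hq : ⁅q₁, q₂ + q₃⁆ = -(3 • z) := by rw [lie_add, hq₁q₂, hq₁q₃, add_zero]
  have hpq : ⁅p, q₁ + (q₂ + q₃)⁆ = z - 2 • y := by
    rw [lie_add, lie_add, hpq₁, hpq₂, hpq₃, zero_add, neg_add_eq_sub]
  have hq₂₃ : IsNilpotent (q₂ + q₃) := hq₂q₃.isNilpotent_add hq₂ hq₃
  have hnq : IsNilpotent ⁅q₁, q₂ + q₃⁆ := hq ▸ (hz.smul 3).neg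
  have hcq₁ : Commute q₁ ⁅q₁, q₂ + q₃⁆ := hq ▸ (hq₁z.smul_right 3).neg_right
  have hcq₂₃ : Commute (q₂ + q₃) ⁅q₁, q₂ + q₃⁆ :=
    hq ▸ ((hq₂z.add_left hq₃z).smul_right 3).neg_right
  have hnpq : IsNilpotent (z - 2 • y) := (hyz.symm.smul_right 2).isNilpotent_sub hz (hy.smul 2)
  have hcentral : ∀ a, Commute a y → Commute a z → Commute a (z - 2 • y) := fun a hay haz =>
    haz.sub_right (hay.smul_right 2)
  rw [exp_add_of_commute_lie hp (isNilpotent_add_of_commute_lie hq₁ hq₂₃ hnq hcq₁ hcq₂₃)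
      (hpq ▸ hnpq) (hpq ▸ hcentral p hpy hpz) (hpq ▸ (hcentral q₁ hq₁y hq₁z).add_left
        ((hcentral q₂ hq₂y hq₂z).add_left (hcentral q₃ hq₃y hq₃z))),
    exp_add_of_commute_lie hq₁ hq₂₃ hnq hcq₁ hcq₂₃, hpq, hq,
    IsNilpotent.exp_add_of_commute hq₂q₃ hq₂ hq₃]
  have hcomm : Commute (-(2⁻¹ : ℚ) • -(3 • z)) (-(2⁻¹ : ℚ) • (z - 2 • y)) :=
    ((hcentral z hyz.symm (.refl z)).smul_left 3).neg_left.smul_left _ |>.smul_right _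
  simp only [mul_assoc]
  rw [← IsNilpotent.exp_add_of_commute hcomm ((hz.smul 3).neg.smul _) (hnpq.smul _),
    ← IsNilpotent.exp_add_of_commute hyz hy hz]
  congr 5
  module

end NilpotentExp

section Group

variable {G : Type*} [Group G]

theorem comm_inv (g h : G) : (comm g h)⁻¹ = comm h g := by
  simp only [comm, mul_inv_rev, inv_inv, mul_assoc]

theorem mul_eq_mul_mul_comm (g h : G) : g * h = h * g * comm g h := by
  simp only [comm, mul_assoc, mul_inv_cancel_left]

theorem comm_eq_one_iff {g h : G} : comm g h = 1 ↔ Commute g h := by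
  rw [comm, mul_assoc, ← mul_inv_rev, inv_mul_eq_one, eq_comm]
  rfl

theorem mul_reverse_of_commute {g₁ g₂ g₃ g₄ c : G}
    (h₂₁ : g₂ * g₁ = g₁ * g₂ * c) (h₁₃ : Commute g₁ g₃) (h₂₃ : Commute g₂ g₃)
    (h₁₄ : Commute g₁ g₄) (h₂₄ : Commute g₂ g₄) (h₃₄ : Commute g₃ g₄) :
    g₄ * g₃ * g₂ * g₁ = g₁ * g₂ * g₃ * (g₄ * c) := by
  have h₄ : Commute (g₁ * g₂ * g₃) g₄ := (h₁₄.mul_left h₂₄).mul_left h₃₄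
  calc g₄ * g₃ * g₂ * g₁ = g₄ * (g₃ * (g₁ * g₂)) * c := by
        rw [mul_assoc _ g₂, h₂₁]; simp only [mul_assoc]
    _ = g₁ * g₂ * g₃ * (g₄ * c) := by
        rw [← (h₁₃.mul_left h₂₃).eq, ← h₄.eq, mul_assoc]

end Group

section Roots

theorem ip_self_pos : ∀ r : Root, 0 < ip r.1 r.1 := by decide

theorem ne_neg_symm {r s : Root} (h : s ≠ -r) : r ≠ -s := fun hrs =>
  h (by rw [hrs]; exact Subtype.ext (neg_neg s.1).symm)

theorem ne_of_add_mem_roots : ∀ r s : Root, r.1 + s.1 ∈ roots → s ≠ r ∧ s ≠ -r := by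
  decide +kernel

theorem det_ne_zero : ∀ r s : Root, s ≠ r → s ≠ -r → r.1.1 * s.1.2 - r.1.2 * s.1.1 ≠ 0 := by
  decide +kernel

theorem smul_add_smul_ne_zero {r s : Root} (h₁ : s ≠ r) (h₂ : s ≠ -r) (i : ℕ) {j : ℕ}
    (hj : j ≠ 0) : i • r.1 + j • s.1 ≠ 0 := by
  intro h
  have hdet : (j : ℤ) * (r.1.1 * s.1.2 - r.1.2 * s.1.1) = 0 := by
    obtain ⟨hfst, hsnd⟩ := Prod.ext_iff.1 h
    simp only [Prod.fst_add, Prod.snd_add, Prod.smul_fst, Prod.smul_snd, Prod.fst_zero,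
      Prod.snd_zero] at hfst hsnd
    simp only [nsmul_eq_mul] at hfst hsnd
    linear_combination r.1.1 * hsnd - r.1.2 * hfst
  exact mul_ne_zero (Nat.cast_ne_zero.2 hj) (det_ne_zero r s h₁ h₂) hdet

theorem mem_of_smul_add_smul_mem_roots : ∀ r s : Root, s ≠ -r →
    ∀ i ∈ Finset.Icc 1 6, ∀ j ∈ Finset.Icc 1 4, i • r.1 + j • s.1 ∈ roots →
      (i, j) ∈ [(1, 1), (2, 1), (1, 2), (3, 1), (1, 3), (3, 2), (2, 3)] := by
  decide +kernel

theorem two_smul_add_notMem_roots : ∀ r s : Root, s ≠ -r → r.1 + s.1 ∉ roots →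
    2 • r.1 + s.1 ∉ roots ∧ r.1 + 2 • s.1 ∉ roots := by
  decide +kernel

theorem smul_add_smul_notMem_roots : ∀ r s : Root, 2 • r.1 + s.1 ∉ roots →
    r.1 + 2 • s.1 ∉ roots → 3 • r.1 + s.1 ∉ roots ∧ r.1 + 3 • s.1 ∉ roots ∧
      3 • r.1 + 2 • s.1 ∉ roots := by
  decide +kernel

theorem add_three_smul_mem_roots : ∀ r s : Root, s ≠ -r →
    2 • r.1 + 3 • s.1 ∈ roots → r.1 + 3 • s.1 ∈ roots := by
  decide +kernel

theorem notMem_roots_of_add_three_smul : ∀ r s : Root, r.1 + 3 • s.1 ∈ roots →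
    2 • r.1 + s.1 ∉ roots ∧ 3 • r.1 + s.1 ∉ roots ∧ 3 • r.1 + 2 • s.1 ∉ roots := by
  decide +kernel

theorem add_mem_roots_of_add_three_smul : ∀ r s : Root, r.1 + 3 • s.1 ∈ roots →
    r.1 + s.1 ∈ roots ∧ r.1 + 2 • s.1 ∈ roots := by
  decide +kernel

theorem two_smul_add_notMem_roots_of_add_three_smul : ∀ r s : Root,
    r.1 + 3 • s.1 ∈ roots → 2 • (r.1 + s.1) + (r.1 + 2 • s.1) ∉ roots ∧
      r.1 + s.1 + 2 • (r.1 + 2 • s.1) ∉ roots := by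
  decide +kernel

theorem add_notMem_roots_of_add_three_smul : ∀ r s : Root,
    r.1 + 3 • s.1 ∈ roots → ∀ v ∈ [r.1 + s.1, r.1 + 2 • s.1, r.1 + 3 • s.1],
      ∀ w ∈ [r.1 + 3 • s.1, 2 • r.1 + 3 • s.1], v + w ≠ 0 ∧ v + w ∉ roots := by
  decide +kernel

theorem strLen_sub : ∀ r s q : Root, r.1 + q.1 = s.1 →
    q ≠ r ∧ q ≠ -r ∧ strLen r s = strLen r q + 1 ∧ cartanInt r s = cartanInt r q + 2 := by
  decide +kernel

theorem cartanInt_lt_strLen : ∀ r s : Root, r.1 + s.1 ∈ roots → cartanInt r s < strLen r s := by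
  decide +kernel

theorem strLen_add_one : ∀ r s : Root, r.1 + s.1 ∈ roots →
    strLen r s + 1 = if s.1 - r.1 ∉ roots then 1 else if s.1 - 2 • r.1 ∉ roots then 2 else 3 := by
  decide +kernel

end Roots

namespace ChevalleyBasis

variable {L : Type*} [LieRing L] [LieAlgebra ℂ L] (C : ChevalleyBasis L)

section StructureConstants

/-- The root vectors `e_v`, extended by zero to the root lattice. -/
noncomputable def rootVec (v : ℤ × ℤ) : L := if h : v ∈ roots then C.e ⟨v, h⟩ else 0

/-- The structure constants `N_{v,w}`, extended by zero to all pairs of elements of the root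
lattice. -/
def structConst (v w : ℤ × ℤ) : ℤ :=
  if h : v ∈ roots ∧ w ∈ roots ∧ v + w ∈ roots then C.N ⟨v, h.1⟩ ⟨w, h.2.1⟩ else 0

theorem rootVec_coe (r : Root) : C.rootVec r.1 = C.e r := dif_pos r.2

theorem rootVec_of_notMem {v : ℤ × ℤ} (h : v ∉ roots) : C.rootVec v = 0 := dif_neg h

theorem structConst_coe {r s : Root} (h : r.1 + s.1 ∈ roots) :
    C.structConst r.1 s.1 = C.N r s := dif_pos ⟨r.2, s.2, h⟩

theorem structConst_of_notMem {v w : ℤ × ℤ} (h : v + w ∉ roots) : C.structConst v w = 0 :=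
  dif_neg fun h' => h h'.2.2

theorem mem_roots_of_structConst_ne_zero {v w : ℤ × ℤ} (h : C.structConst v w ≠ 0) :
    v ∈ roots ∧ w ∈ roots ∧ v + w ∈ roots := by
  by_contra h'
  exact h (dif_neg h')

theorem natAbs_structConst {r s : Root} (h : r.1 + s.1 ∈ roots) :
    (C.structConst r.1 s.1).natAbs = strLen r s + 1 := by
  obtain ⟨h₁, h₂⟩ := ne_of_add_mem_roots r s h
  obtain ⟨-, h₃, h₄, -⟩ := string_step r s h₁ h₂
  have hN := C.N_eq r s h _ h₃ h₄
  rw [C.structConst_coe h]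
  omega

theorem lie_rootVec {v w : ℤ × ℤ} (h : v + w ≠ 0) :
    ⁅C.rootVec v, C.rootVec w⁆ = C.structConst v w • C.rootVec (v + w) := by
  by_cases hv : v ∈ roots
  swap
  · rw [C.rootVec_of_notMem hv, zero_lie, structConst, dif_neg (by tauto), zero_smul]
  by_cases hw : w ∈ roots
  swap
  · rw [C.rootVec_of_notMem hw, lie_zero, structConst, dif_neg (by tauto), zero_smul]
  lift v to Root using hv
  lift w to Root using hw
  rw [C.rootVec_coe, C.rootVec_coe]
  by_cases hvw : v.1 + w.1 ∈ roots
  · rw [C.structConst_coe hvw, C.lie_e_e v w ⟨_, hvw⟩ rfl, ← C.rootVec_coe]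
  · rw [C.lie_e_e_eq_zero v w h hvw, C.rootVec_of_notMem hvw, smul_zero]

theorem lie_lie_rootVec {v w q : ℤ × ℤ} (hvw : v + w ≠ 0) (hq : q + (v + w) ≠ 0) :
    ⁅C.rootVec q, ⁅C.rootVec v, C.rootVec w⁆⁆ =
      (C.structConst v w * C.structConst q (v + w)) • C.rootVec (q + (v + w)) := by
  rw [C.lie_rootVec hvw, lie_smul, C.lie_rootVec hq, mul_smul]

theorem zsmul_rootVec_injective {v : ℤ × ℤ} (hv : v ∈ roots) {m n : ℤ}
    (h : m • C.rootVec v = n • C.rootVec v) : m = n := by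
  lift v to Root using hv
  rw [C.rootVec_coe, ← Int.cast_smul_eq_zsmul ℂ, ← Int.cast_smul_eq_zsmul ℂ] at h
  exact_mod_cast smul_left_injective ℂ (C.linearIndependent.ne_zero (Sum.inr v)) h

theorem structConst_swap (v w : ℤ × ℤ) : C.structConst w v = -C.structConst v w := by
  by_cases h : v + w ∈ roots
  · have h0 : v + w ≠ 0 := fun h0 => absurd (h0 ▸ h) (by decide)
    refine C.zsmul_rootVec_injective h ?_
    rw [neg_smul, ← C.lie_rootVec h0, lie_skew, C.lie_rootVec (add_comm v w ▸ h0), add_comm w v]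
  · rw [C.structConst_of_notMem h, C.structConst_of_notMem (add_comm v w ▸ h), neg_zero]

theorem structConst_jacobi {v w q : ℤ × ℤ} (hvw : v + w ≠ 0) (hwq : w + q ≠ 0)
    (hqv : q + v ≠ 0) :
    C.structConst v w * C.structConst q (v + w) + C.structConst w q * C.structConst v (w + q) +
      C.structConst q v * C.structConst w (q + v) = 0 := by
  have hv : v + (w + q) = q + (v + w) := by abel
  have hw : w + (q + v) = q + (v + w) := by abel
  by_cases h : q + (v + w) ∈ roots
  · have h0 : q + (v + w) ≠ 0 := fun h0 => absurd (h0 ▸ h) (by decide)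
    have hJ := lie_jacobi (C.rootVec q) (C.rootVec v) (C.rootVec w)
    rw [C.lie_lie_rootVec hvw h0, C.lie_lie_rootVec hwq (hv ▸ h0), C.lie_lie_rootVec hqv (hw ▸ h0),
      hv, hw, ← add_smul, ← add_smul] at hJ
    exact C.zsmul_rootVec_injective h (hJ.trans (zero_smul ℤ _).symm)
  · rw [C.structConst_of_notMem h, C.structConst_of_notMem (hv ▸ h : v + (w + q) ∉ roots),
      C.structConst_of_notMem (hw ▸ h : w + (q + v) ∉ roots), mul_zero, mul_zero, mul_zero,
      add_zero, add_zero]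

theorem structConst_mul_structConst_add {r s : Root} (h₁ : s ≠ r) (h₂ : s ≠ -r) :
    C.structConst r.1 s.1 * C.structConst (r.1 + s.1) (2 • r.1 + s.1) =
      -(C.structConst r.1 (2 • r.1 + s.1) * C.structConst s.1 (3 • r.1 + s.1)) := by
  have h11 := smul_add_smul_ne_zero h₁ h₂ 1 one_ne_zero
  have h22 := smul_add_smul_ne_zero h₁ h₂ 2 two_ne_zero
  have h31 := smul_add_smul_ne_zero h₁ h₂ 3 one_ne_zero
  have e22 : s.1 + (2 • r.1 + s.1) = 2 • r.1 + 2 • s.1 := by abel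
  have e31 : 2 • r.1 + s.1 + r.1 = 3 • r.1 + s.1 := by abel
  have h22' : s.1 + (2 • r.1 + s.1) ∉ roots := fun h => by
    simpa using mem_of_smul_add_smul_mem_roots r s h₂ 2 (by decide) 2 (by decide) (e22 ▸ h)
  rw [one_smul, one_smul] at h11
  rw [one_smul] at h31
  have hJ := C.structConst_jacobi h11 (e22 ▸ h22) (e31 ▸ h31)
  rw [C.structConst_of_notMem h22', C.structConst_swap r.1 (2 • r.1 + s.1), e31,
    C.structConst_swap (r.1 + s.1)] at hJ
  linear_combination -hJ

/-- Carter's constants `M_{v,w,i} = N_{v,w} N_{v,v+w} ⋯ N_{v,(i-1)v+w} / i!`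
(the division is exact for roots `w ≠ ±v`). -/
def chainConst (v w : ℤ × ℤ) (i : ℕ) : ℤ :=
  (∏ k ∈ Finset.range i, C.structConst v (k • v + w)) / i.factorial

theorem prod_structConst_eq_zero_or {r s : Root} (h₁ : s ≠ r) (h₂ : s ≠ -r) (i : ℕ) :
    ∏ k ∈ Finset.range i, C.structConst r.1 (k • r.1 + s.1) = 0 ∨
      (∏ k ∈ Finset.range i, C.structConst r.1 (k • r.1 + s.1)).natAbs =
        (strLen r s + 1).ascFactorial i := by
  induction i generalizing s with
  | zero => simp
  | succ i ih =>
    rw [Finset.prod_range_succ']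
    by_cases hrs : r.1 + s.1 ∈ roots
    · obtain ⟨h₁', h₂', hlen⟩ := (string_step r s h₁ h₂).2.2.2 ⟨_, hrs⟩ rfl
      have hshift (k : ℕ) : (k + 1) • r.1 + s.1 = k • r.1 + (r.1 + s.1) := by
        rw [succ_nsmul, add_assoc]
      simp only [hshift, zero_smul, zero_add]
      refine (ih h₁' h₂').imp (fun h => by rw [h, zero_mul]) fun h => ?_
      rw [Int.natAbs_mul, h, C.natAbs_structConst hrs, hlen, mul_comm, Nat.succ_ascFactorial,
        Nat.ascFactorial_succ]
    · left
      rw [zero_smul, zero_add, C.structConst_of_notMem hrs, mul_zero]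

theorem factorial_mul_chainConst {r s : Root} (h₁ : s ≠ r) (h₂ : s ≠ -r) (i : ℕ) :
    i.factorial * C.chainConst r.1 s.1 i =
      ∏ k ∈ Finset.range i, C.structConst r.1 (k • r.1 + s.1) := by
  refine Int.mul_ediv_cancel' ?_
  rcases C.prod_structConst_eq_zero_or h₁ h₂ i with h | h
  · rw [h]; exact dvd_zero _
  · rw [← Int.dvd_natAbs, h]
    exact_mod_cast Nat.factorial_dvd_ascFactorial _ i

theorem chainConst_zero (v w : ℤ × ℤ) : C.chainConst v w 0 = 1 := by simp [chainConst]

theorem chainConst_one (v w : ℤ × ℤ) : C.chainConst v w 1 = C.structConst v w := by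
  simp [chainConst]

theorem succ_mul_chainConst_succ {r s : Root} (h₁ : s ≠ r) (h₂ : s ≠ -r) (i : ℕ) :
    (i + 1) * C.chainConst r.1 s.1 (i + 1) =
      C.chainConst r.1 s.1 i * C.structConst r.1 (i • r.1 + s.1) := by
  have hsucc := C.factorial_mul_chainConst h₁ h₂ (i + 1)
  rw [Finset.prod_range_succ, ← C.factorial_mul_chainConst h₁ h₂ i, Nat.factorial_succ] at hsucc
  have hfac : (i.factorial : ℤ) ≠ 0 := Nat.cast_ne_zero.2 i.factorial_ne_zero
  refine mul_left_cancel₀ hfac ?_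
  push_cast at hsucc
  linear_combination hsucc

theorem two_mul_chainConst_two {r s : Root} (h₁ : s ≠ r) (h₂ : s ≠ -r) :
    2 * C.chainConst r.1 s.1 2 = C.structConst r.1 s.1 * C.structConst r.1 (r.1 + s.1) := by
  simpa [chainConst_one] using C.succ_mul_chainConst_succ h₁ h₂ 1

theorem three_mul_chainConst_three {r s : Root} (h₁ : s ≠ r) (h₂ : s ≠ -r) :
    3 * C.chainConst r.1 s.1 3 = C.chainConst r.1 s.1 2 * C.structConst r.1 (2 • r.1 + s.1) :=
  C.succ_mul_chainConst_succ h₁ h₂ 2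

theorem chainConst_mul_structConst {r s : Root} (h₁ : s ≠ r) (h₂ : s ≠ -r) :
    C.chainConst r.1 s.1 1 * C.chainConst s.1 r.1 2 *
        C.structConst (r.1 + s.1) (r.1 + 2 • s.1) =
      3 * C.chainConst s.1 r.1 3 * C.structConst r.1 (r.1 + 3 • s.1) := by
  have hJ := C.structConst_mul_structConst_add h₁.symm (ne_neg_symm h₂)
  have hM := C.three_mul_chainConst_three h₁.symm (ne_neg_symm h₂)
  rw [add_comm s.1, add_comm _ r.1, add_comm _ r.1, C.structConst_swap r.1 s.1] at hJ
  rw [add_comm _ r.1] at hM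
  rw [C.chainConst_one]
  linear_combination C.chainConst s.1 r.1 2 * (-hJ) - C.structConst r.1 (r.1 + 3 • s.1) * hM

end StructureConstants

section Signs

variable {r s q : Root} {v w : ℤ × ℤ}

theorem lie_lie_e_of_add_eq_zero (h : r.1 + s.1 + q.1 = 0) :
    ⁅C.e q, ⁅C.e r, C.e s⁆⁆ = C.structConst r.1 s.1 • C.h q := by
  have hrs : r.1 + s.1 = (-q).1 := eq_neg_of_add_eq_zero_left h
  rw [C.lie_e_e r s (-q) hrs, lie_zsmul, C.lie_e_neg, C.structConst_coe (hrs ▸ (-q).2)]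

theorem h_eq_div_smul (r : Root) :
    C.h r = (r.1.1 * 2 / ip r.1 r.1 : ℂ) • C.h (rt 1 0) +
      (r.1.2 * 6 / ip r.1 r.1 : ℂ) • C.h (rt 0 1) := by
  have hr : (ip r.1 r.1 : ℂ) ≠ 0 := by exact_mod_cast (ip_self_pos r).ne'
  refine smul_right_injective L hr ?_
  have hip := C.ip_smul_h r
  rw [show ip (1, 0) (1, 0) = 2 from rfl, show ip (0, 1) (0, 1) = 6 from rfl] at hip
  simp only [← Int.cast_smul_eq_zsmul ℂ] at hip
  simp only [smul_add, smul_smul, mul_div_cancel₀ _ hr]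
  exact_mod_cast hip

theorem structConst_div_ip (h : r.1 + s.1 + q.1 = 0) :
    (C.structConst r.1 s.1 / ip q.1 q.1 : ℂ) = C.structConst s.1 q.1 / ip r.1 r.1 := by
  have hq : q.1 = -(r.1 + s.1) := eq_neg_of_add_eq_zero_right h
  have hrs : r.1 + s.1 ∈ roots := eq_neg_of_add_eq_zero_left h ▸ (-q).2
  have hJ := lie_jacobi (C.e q) (C.e r) (C.e s)
  rw [C.lie_lie_e_of_add_eq_zero h, C.lie_lie_e_of_add_eq_zero (by rw [hq]; abel),
    C.lie_lie_e_of_add_eq_zero (by rw [hq]; abel), C.h_eq_div_smul q, C.h_eq_div_smul r,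
    C.h_eq_div_smul s] at hJ
  have hind := C.linearIndependent.comp Sum.inl Sum.inl_injective
  rw [Sum.elim_comp_inl, LinearIndependent.pair_iff] at hind
  simp only [← Int.cast_smul_eq_zsmul ℂ] at hJ
  set cq : ℂ := C.structConst r.1 s.1 / ip q.1 q.1 with hcq
  set cr : ℂ := C.structConst s.1 q.1 / ip r.1 r.1 with hcr
  set cs : ℂ := C.structConst q.1 r.1 / ip s.1 s.1 with hcs
  obtain ⟨ha, hb⟩ := hind (2 * (cq * q.1.1 + cr * r.1.1 + cs * s.1.1))
    (6 * (cq * q.1.2 + cr * r.1.2 + cs * s.1.2)) (hJ ▸ by rw [hcq, hcr, hcs]; module)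
  obtain ⟨h₁, h₂⟩ := ne_of_add_mem_roots r s hrs
  have hdet : (r.1.1 * s.1.2 - r.1.2 * s.1.1 : ℂ) ≠ 0 := by
    exact_mod_cast det_ne_zero r s h₁ h₂
  rw [hq] at ha hb
  push_cast [Prod.fst_neg, Prod.snd_neg, Prod.fst_add, Prod.snd_add] at ha hb
  refine mul_left_cancel₀ hdet ?_
  linear_combination -s.1.2 / 2 * ha + s.1.1 / 6 * hb

theorem structConst_rotate_pos (h : 0 < C.structConst v w) : 0 < C.structConst w (-(v + w)) := by
  obtain ⟨hv, hw, hvw⟩ := C.mem_roots_of_structConst_ne_zero h.ne'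
  lift v to Root using hv
  lift w to Root using hw
  obtain ⟨q, hq⟩ : ∃ q : Root, q.1 = -(v.1 + w.1) := ⟨-⟨_, hvw⟩, rfl⟩
  have hdiv := C.structConst_div_ip (hq ▸ add_neg_cancel (v.1 + w.1) : v.1 + w.1 + q.1 = 0)
  have hvpos := ip_self_pos v
  have hqpos := ip_self_pos q
  rw [div_eq_div_iff (by exact_mod_cast hqpos.ne') (by exact_mod_cast hvpos.ne')] at hdiv
  norm_cast at hdiv
  exact hq ▸ pos_of_mul_pos_left (hdiv ▸ mul_pos h hvpos) hqpos.le

theorem lie_rootVec_neg (r : Root) : ⁅C.rootVec r.1, C.rootVec (-r.1)⁆ = C.h r := by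
  rw [← C.lie_e_neg, ← C.rootVec_coe, ← C.rootVec_coe]
  rfl

theorem cartanInt_eq_sub (h₁ : s ≠ r) (h₂ : s ≠ -r) :
    cartanInt r s = C.structConst (-r.1) s.1 * C.structConst r.1 (-r.1 + s.1) -
      C.structConst r.1 s.1 * C.structConst (-r.1) (r.1 + s.1) := by
  have hs : s.1 ≠ 0 := fun h => absurd (h ▸ s.2) (by decide)
  have hJ := lie_lie (C.rootVec r.1) (C.rootVec (-r.1)) (C.rootVec s.1)
  have hrs : r.1 + s.1 ≠ 0 := fun h => h₂ (Subtype.ext (eq_neg_of_add_eq_zero_right h))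
  have hrs' : -r.1 + s.1 ≠ 0 := fun h => h₁ (Subtype.ext (neg_add_eq_zero.1 h).symm)
  rw [C.lie_lie_rootVec hrs' (by rwa [add_neg_cancel_left]),
    C.lie_lie_rootVec hrs (by rwa [neg_add_cancel_left]), add_neg_cancel_left,
    neg_add_cancel_left, ← sub_smul, C.lie_rootVec_neg, C.rootVec_coe, C.lie_h_e,
    ← C.rootVec_coe] at hJ
  exact C.zsmul_rootVec_injective s.2 hJ

theorem structConst_mul_structConst_neg (h₁ : s ≠ r) (h₂ : s ≠ -r) :
    C.structConst r.1 s.1 * C.structConst (-r.1) (r.1 + s.1) =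
      (strLen r s + 1) * (strLen r s - cartanInt r s) := by
  induction hp : strLen r s generalizing s with
  | zero =>
    have hA := C.cartanInt_eq_sub h₁ h₂
    have hsr : -r.1 + s.1 ∉ roots := fun h => by
      have := (strLen_sub r s ⟨_, h⟩ (add_neg_cancel_left _ _)).2.2.1
      omega
    rw [C.structConst_of_notMem hsr] at hA
    push_cast
    linear_combination hA
  | succ p ih =>
    have hA := C.cartanInt_eq_sub h₁ h₂
    obtain ⟨-, hmem, -⟩ := string_step r s h₁ h₂
    have hq := hmem 1 (by omega)
    rw [one_smul, sub_eq_neg_add] at hq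
    obtain ⟨hq₁, hq₂, hlen, hcartan⟩ := strLen_sub r s ⟨_, hq⟩ (add_neg_cancel_left _ _)
    have hih := ih hq₁ hq₂ (by omega)
    rw [add_neg_cancel_left] at hih
    push_cast
    linear_combination hA + hih + (p + 1) * hcartan

theorem structConst_neg_add_pos (h : 0 < C.structConst v w) : 0 < C.structConst (-v) (v + w) := by
  obtain ⟨hv, hw, hvw⟩ := C.mem_roots_of_structConst_ne_zero h.ne'
  lift v to Root using hv
  lift w to Root using hw
  obtain ⟨h₁, h₂⟩ := ne_of_add_mem_roots v w hvw
  have hlt := cartanInt_lt_strLen v w hvw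
  refine pos_of_mul_pos_right ?_ h.le
  rw [C.structConst_mul_structConst_neg h₁ h₂]
  exact mul_pos (by positivity) (by linarith)

end Signs

end ChevalleyBasis

section ExtraspecialPairs

/-- The pairs `(v, w)` of roots, one for each orbit of `(v, w) ↦ (w, -(v + w))` and
`(v, w) ↦ (-v, v + w)`, for which `N_{v,w}` is positive as soon as the structure constants of the
extraspecial pairs are. -/
def positivePairs : List ((ℤ × ℤ) × (ℤ × ℤ)) :=
  [((1, 0), (0, 1)), ((1, 0), (1, 1)), ((1, 0), (2, 1)), ((0, 1), (3, 1)), ((2, 1), (1, 1))]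

/-- The pair `(v, w)` lies in the orbit of one of the `positivePairs`. -/
def IsPositive (v w : ℤ × ℤ) : Prop :=
  (v, w) ∈ positivePairs ∨ (w, -(v + w)) ∈ positivePairs ∨ (-(v + w), v) ∈ positivePairs ∨
    (-w, -v) ∈ positivePairs ∨ (v + w, -w) ∈ positivePairs ∨ (-v, v + w) ∈ positivePairs

instance (v w : ℤ × ℤ) : Decidable (IsPositive v w) := by unfold IsPositive; infer_instance

/-- The structure constant `N_{v,w}` determined by positive structure constants of the
extraspecial pairs: its absolute value `p + 1` is the number of the roots `w, w - v, …, w - p v`. -/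
def extraspecialConst (v w : ℤ × ℤ) : ℤ :=
  if v ∈ roots ∧ w ∈ roots ∧ v + w ∈ roots then
    (if IsPositive v w then 1 else -1) *
      (if w - v ∉ roots then 1 else if w - 2 • v ∉ roots then 2 else 3 : ℕ)
  else 0

theorem isPositive_or_swap : ∀ r s : Root, r.1 + s.1 ∈ roots →
    IsPositive r.1 s.1 ∨ IsPositive s.1 r.1 := by
  decide +kernel

namespace ChevalleyBasis

variable {L : Type*} [LieRing L] [LieAlgebra ℂ L] {C : ChevalleyBasis L} {v w : ℤ × ℤ}

variable (C) in
/-- The structure constants of the extraspecial pairs are positive. -/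
structure IsExtraspecialPos : Prop where
  a_b : 0 < C.N (rt 1 0) (rt 0 1)
  a_ab : 0 < C.N (rt 1 0) (rt 1 1)
  a_2ab : 0 < C.N (rt 1 0) (rt 2 1)
  b_3ab : 0 < C.N (rt 0 1) (rt 3 1)

theorem IsExtraspecialPos.structConst_two_one_pos (hC : C.IsExtraspecialPos) :
    0 < C.structConst (2, 1) (1, 1) := by
  have hJ : C.structConst (1, 0) (0, 1) * C.structConst (2, 1) (1, 1) +
      C.structConst (0, 1) (2, 1) * C.structConst (1, 0) (2, 2) +
      C.structConst (2, 1) (1, 0) * C.structConst (0, 1) (3, 1) = 0 :=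
    C.structConst_jacobi (by decide) (by decide) (by decide)
  have hzero : C.structConst (0, 1) (2, 1) = 0 := C.structConst_of_notMem (by decide)
  have hab : 0 < C.structConst (1, 0) (0, 1) := hC.a_b
  have hpos : 0 < C.structConst (1, 0) (2, 1) * C.structConst (0, 1) (3, 1) :=
    mul_pos hC.a_2ab hC.b_3ab
  rw [hzero, C.structConst_swap (1, 0) (2, 1)] at hJ
  exact pos_of_mul_pos_right (by linarith) hab.le

theorem IsExtraspecialPos.structConst_pos_of_mem_positivePairs (hC : C.IsExtraspecialPos)
    (h : (v, w) ∈ positivePairs) : 0 < C.structConst v w := by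
  simp only [positivePairs, List.mem_cons, Prod.mk.injEq, List.not_mem_nil, or_false] at h
  rcases h with ⟨rfl, rfl⟩ | ⟨rfl, rfl⟩ | ⟨rfl, rfl⟩ | ⟨rfl, rfl⟩ | ⟨rfl, rfl⟩
  exacts [hC.a_b, hC.a_ab, hC.a_2ab, hC.b_3ab, hC.structConst_two_one_pos]

theorem IsExtraspecialPos.structConst_pos (hC : C.IsExtraspecialPos) (h : IsPositive v w) :
    0 < C.structConst v w := by
  have rotate {v w : ℤ × ℤ} (h : 0 < C.structConst (-(v + w)) v) : 0 < C.structConst v w := by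
    simpa using C.structConst_rotate_pos h
  have opposite {v w : ℤ × ℤ} (h : 0 < C.structConst (-v) (v + w)) : 0 < C.structConst v w := by
    simpa using C.structConst_neg_add_pos h
  have positive {v w : ℤ × ℤ} := hC.structConst_pos_of_mem_positivePairs (v := v) (w := w)
  rcases h with h | h | h | h | h | h
  · exact positive h
  · exact rotate (rotate (by simpa using positive h))
  · exact rotate (positive h)
  · exact opposite (rotate (by simpa using positive h))
  · exact opposite (rotate (rotate (by simpa using positive h)))
  · exact opposite (positive h)

theorem IsExtraspecialPos.structConst_eq (hC : C.IsExtraspecialPos) (v w : ℤ × ℤ) :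
    C.structConst v w = extraspecialConst v w := by
  by_cases h : v ∈ roots ∧ w ∈ roots ∧ v + w ∈ roots
  swap
  · rw [structConst, dif_neg h, extraspecialConst, if_neg h]
  rw [extraspecialConst, if_pos h]
  obtain ⟨hv, hw, hvw⟩ := h
  lift v to Root using hv
  lift w to Root using hw
  have habs := C.natAbs_structConst hvw
  rw [← strLen_add_one v w hvw]
  split_ifs with hpos
  · have := hC.structConst_pos hpos
    omega
  · have hneg := hC.structConst_pos ((isPositive_or_swap v w hvw).resolve_left hpos)
    rw [C.structConst_swap v.1 w.1] at hneg
    omega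

end ChevalleyBasis

end ExtraspecialPairs

namespace ChevalleyBasis

variable {L : Type*} [LieRing L] [LieAlgebra ℂ L] (C : ChevalleyBasis L)
variable {K : Type*} [CommRing K]

section RootOperators

/-- The operator `ad e_v` on the integral form, extended by zero to the root lattice. -/
noncomputable def adInt (v : ℤ × ℤ) : Module.End ℤ C.lattice :=
  if h : v ∈ roots then C.intDivPow ⟨v, h⟩ 1 else 0

theorem coe_adInt_apply (v : ℤ × ℤ) (y : C.lattice) :
    (C.adInt v y : L) = ⁅C.rootVec v, (y : L)⁆ := by
  by_cases hv : v ∈ roots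
  · simp [adInt, rootVec, hv, intDivPow, divPow]
  · simp [adInt, rootVec, hv]

theorem lie_adInt {v w : ℤ × ℤ} (h : v + w ≠ 0) :
    ⁅C.adInt v, C.adInt w⁆ = C.structConst v w • C.adInt (v + w) := by
  ext y
  simp [Ring.lie_def, coe_adInt_apply, ← lie_lie, C.lie_rootVec h]

theorem adInt_pow (r : Root) (i : ℕ) : C.adInt r.1 ^ i = i.factorial • C.intDivPow r i := by
  induction i with
  | zero => simp [intDivPow_zero]
  | succ i ih =>
    rw [pow_succ, ih, adInt, dif_pos r.2, smul_mul_assoc, C.intDivPow_mul, smul_smul,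
      Nat.choose_symm_add, Nat.choose_one_right, Nat.factorial_succ, mul_comm]

variable (K) in
/-- The operator `ad e_v` on `L_K`, extended by zero to the root lattice. -/
noncomputable def rootAd (v : ℤ × ℤ) : Module.End K (C.Form K) :=
  (C.adInt v).baseChange K

theorem rootAd_of_notMem {v : ℤ × ℤ} (h : v ∉ roots) : C.rootAd K v = 0 := by
  rw [rootAd, adInt, dif_neg h, LinearMap.baseChange_zero]

theorem lie_rootAd {v w : ℤ × ℤ} (h : v + w ≠ 0) :
    ⁅C.rootAd K v, C.rootAd K w⁆ = C.structConst v w • C.rootAd K (v + w) := by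
  have hbase := congrArg (Module.End.baseChangeHom ℤ K C.lattice) (C.lie_adInt h)
  rwa [Ring.lie_def, map_sub, map_mul, map_mul, map_zsmul] at hbase

theorem lie_smul_rootAd {v w : ℤ × ℤ} (h : v + w ≠ 0) (c d : K) :
    ⁅c • C.rootAd K v, d • C.rootAd K w⁆ =
      (c * d * C.structConst v w) • C.rootAd K (v + w) := by
  have hlie := C.lie_rootAd (K := K) h
  rw [Ring.lie_def] at hlie ⊢
  rw [smul_mul_smul_comm, smul_mul_smul_comm, mul_comm d c, mul_smul _ (Int.cast _),
    Int.cast_smul_eq_zsmul, ← hlie]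
  exact (smul_sub _ _ _).symm

theorem rootAd_pow (r : Root) (i : ℕ) :
    C.rootAd K r.1 ^ i = i.factorial • (C.intDivPow r i).baseChange K := by
  have hbase := congrArg (Module.End.baseChangeHom ℤ K C.lattice) (C.adInt_pow r i)
  rwa [map_pow, map_nsmul] at hbase

theorem isNilpotent_rootAd (v : ℤ × ℤ) : IsNilpotent (C.rootAd K v) := by
  by_cases hv : v ∈ roots
  · refine ⟨4, ?_⟩
    rw [C.rootAd_pow ⟨v, hv⟩, C.intDivPow_of_le _ _ le_rfl, LinearMap.baseChange_zero, smul_zero]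
  · simp [C.rootAd_of_notMem hv]

/-- The operator `exp (z ad e_v)` on `L_K`, extended by the identity to the root lattice. -/
noncomputable def rootExp (v : ℤ × ℤ) (z : K) : Module.End K (C.Form K) :=
  if h : v ∈ roots then C.rootEnd ⟨v, h⟩ z else 1

theorem rootExp_coe (r : Root) (z : K) : C.rootExp r.1 z = C.rootEnd r z := dif_pos r.2

theorem rootExp_of_notMem {v : ℤ × ℤ} (h : v ∉ roots) (z : K) : C.rootExp v z = 1 :=
  dif_neg h

theorem rootExp_mul (v : ℤ × ℤ) (y z : K) :
    C.rootExp v y * C.rootExp v z = C.rootExp v (y + z) := by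
  by_cases hv : v ∈ roots
  · lift v to Root using hv
    rw [C.rootExp_coe, C.rootExp_coe, C.rootExp_coe, C.rootEnd_mul]
  · rw [C.rootExp_of_notMem hv, C.rootExp_of_notMem hv, C.rootExp_of_notMem hv, one_mul]

theorem rootExp_zero (v : ℤ × ℤ) : C.rootExp v (0 : K) = 1 := by
  by_cases hv : v ∈ roots
  · lift v to Root using hv
    rw [C.rootExp_coe, C.rootEnd_zero]
  · rw [C.rootExp_of_notMem hv]

theorem rootExp_eq_exp [Algebra ℚ K] (v : ℤ × ℤ) (z : K) :
    C.rootExp v z = IsNilpotent.exp (z • C.rootAd K v) := by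
  by_cases hv : v ∈ roots
  · lift v to Root using hv
    have h4 : (z • C.rootAd K v) ^ 4 = 0 := by
      rw [smul_pow, C.rootAd_pow, C.intDivPow_of_le _ _ le_rfl, LinearMap.baseChange_zero,
        smul_zero, smul_zero]
    rw [IsNilpotent.exp_eq_sum h4, rootExp_coe, rootEnd]
    refine Finset.sum_congr rfl fun i _ => ?_
    rw [smul_pow, C.rootAd_pow, ← Nat.cast_smul_eq_nsmul ℚ, smul_comm (z ^ i),
      inv_smul_smul₀ (Nat.cast_ne_zero.2 i.factorial_ne_zero)]
  · rw [C.rootExp_of_notMem hv, C.rootAd_of_notMem hv, smul_zero, IsNilpotent.exp_zero]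

end RootOperators

section CommutatorFormula

variable {r s : Root}

/-- The composite of the operators `exp (z ad e_v)` on `L_K`, for the pairs `(v, z)` in a list. -/
noncomputable def wordExp (l : List ((ℤ × ℤ) × K)) : Module.End K (C.Form K) :=
  (l.map fun p => C.rootExp p.1 p.2).prod

/-- The factors `(k, z)` of the commutator formula for roots `v` and `w` with `v + 3w ∉ Φ`:
the composite of the `exp (z ad e_k)` is the commutator of `exp (u ad e_w)` and
`exp (-c ad e_v)`. -/
def commWord (v w : ℤ × ℤ) (c u : K) : List ((ℤ × ℤ) × K) :=
  [(v + w, c * u * C.chainConst v w 1),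
    (2 • v + w, c ^ 2 * u * C.chainConst v w 2),
    (3 • v + w, c ^ 3 * u * C.chainConst v w 3),
    (v + 2 • w, c * u ^ 2 * C.chainConst w v 2),
    (3 • v + 2 • w, c ^ 3 * u ^ 2 * C.chainConst v w 3 * C.structConst w (3 • v + w))]

theorem ad_pow_smul_rootAd [Algebra ℚ K] (h₁ : s ≠ r) (h₂ : s ≠ -r) (c d : K) (i : ℕ) :
    (LieAlgebra.ad ℚ (Module.End K (C.Form K)) (c • C.rootAd K r.1) ^ i) (d • C.rootAd K s.1) =
      (c ^ i * d * (∏ k ∈ Finset.range i, C.structConst r.1 (k • r.1 + s.1) : ℤ)) •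
        C.rootAd K (i • r.1 + s.1) := by
  induction i with
  | zero => simp
  | succ i ih =>
    have hadd : r.1 + (i • r.1 + s.1) = (i + 1) • r.1 + s.1 := by rw [succ_nsmul]; abel
    have h0 := smul_add_smul_ne_zero h₁ h₂ (i + 1) one_ne_zero
    rw [one_smul, ← hadd] at h0
    rw [pow_succ', Module.End.mul_apply, ih, LieAlgebra.ad_apply, C.lie_smul_rootAd h0, hadd,
      Finset.prod_range_succ]
    push_cast
    congr 1
    ring

theorem exp_ad_smul_rootAd [Algebra ℚ K] (h₁ : s ≠ r) (h₂ : s ≠ -r) (c d : K) :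
    IsNilpotent.exp (LieAlgebra.ad ℚ (Module.End K (C.Form K)) (c • C.rootAd K r.1))
        (d • C.rootAd K s.1) =
      ∑ i ∈ Finset.range 4, (c ^ i * d * C.chainConst r.1 s.1 i) • C.rootAd K (i • r.1 + s.1) := by
  have h4 : (LieAlgebra.ad ℚ (Module.End K (C.Form K)) (c • C.rootAd K r.1) ^ 4) •
      (d • C.rootAd K s.1) = 0 := by
    have h41 : 4 • r.1 + s.1 ∉ roots := fun h => by
      simpa using mem_of_smul_add_smul_mem_roots r s h₂ 4 (by decide) 1 (by decide)
        (by rwa [one_smul])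
    rw [Module.End.smul_def, C.ad_pow_smul_rootAd h₁ h₂, C.rootAd_of_notMem h41, smul_zero]
  rw [← Module.End.smul_def, IsNilpotent.exp_smul_eq_sum h4
    (LieAlgebra.ad_nilpotent_of_nilpotent ((C.isNilpotent_rootAd r.1).smul c))]
  refine Finset.sum_congr rfl fun i _ => ?_
  have hfac : (i.factorial : ℚ) ≠ 0 := Nat.cast_ne_zero.2 i.factorial_ne_zero
  rw [Module.End.smul_def, C.ad_pow_smul_rootAd h₁ h₂, ← C.factorial_mul_chainConst h₁ h₂,
    inv_smul_eq_iff₀ hfac, Nat.cast_smul_eq_nsmul, ← smul_assoc, nsmul_eq_mul]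
  push_cast
  congr 1
  ring

theorem lie_smul_rootAd_smul_add_smul (h₁ : s ≠ r) (h₂ : s ≠ -r) {i j k l : ℕ} (c d : K)
    (hj : j + l ≠ 0) :
    ⁅c • C.rootAd K (i • r.1 + j • s.1), d • C.rootAd K (k • r.1 + l • s.1)⁆ =
      (c * d * C.structConst (i • r.1 + j • s.1) (k • r.1 + l • s.1)) •
        C.rootAd K ((i + k) • r.1 + (j + l) • s.1) := by
  have hadd : i • r.1 + j • s.1 + (k • r.1 + l • s.1) = (i + k) • r.1 + (j + l) • s.1 := by
    rw [add_smul, add_smul]; abel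
  rw [C.lie_smul_rootAd (hadd ▸ smul_add_smul_ne_zero h₁ h₂ (i + k) hj), hadd]

theorem commute_smul_rootAd_smul_add_smul (h₁ : s ≠ r) (h₂ : s ≠ -r) {i j k l : ℕ} (c d : K)
    (hj : j + l ≠ 0) (h : (i + k) • r.1 + (j + l) • s.1 ∉ roots) :
    Commute (c • C.rootAd K (i • r.1 + j • s.1)) (d • C.rootAd K (k • r.1 + l • s.1)) := by
  rw [commute_iff_lie_eq, C.lie_smul_rootAd_smul_add_smul h₁ h₂ c d hj, C.rootAd_of_notMem h,
    smul_zero]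

theorem lie_smul_rootAd_chain_one (h₁ : s ≠ r) (h₂ : s ≠ -r) (c u : K) :
    ⁅u • C.rootAd K (0 • r.1 + 1 • s.1),
        (c * u * C.chainConst r.1 s.1 1) • C.rootAd K (1 • r.1 + 1 • s.1)⁆ =
      -(2 • (c * u ^ 2 * C.chainConst s.1 r.1 2) • C.rootAd K (1 • r.1 + 2 • s.1)) := by
  rw [C.lie_smul_rootAd_smul_add_smul h₁ h₂ _ _ (by decide), ← smul_assoc]
  refine Eq.trans ?_ (neg_smul _ _)
  congr 1
  have hM := congrArg (Int.cast : ℤ → K) (C.two_mul_chainConst_two h₁.symm (ne_neg_symm h₂))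
  rw [C.structConst_swap r.1, add_comm s.1] at hM
  rw [zero_smul, zero_add, one_smul, one_smul, C.chainConst_one]
  push_cast at hM
  rw [nsmul_eq_mul, Nat.cast_ofNat]
  linear_combination c * u ^ 2 * hM

theorem lie_smul_rootAd_chain_one_two (h₁ : s ≠ r) (h₂ : s ≠ -r) (c u : K) :
    ⁅(c * u * C.chainConst r.1 s.1 1) • C.rootAd K (1 • r.1 + 1 • s.1),
        (c ^ 2 * u * C.chainConst r.1 s.1 2) • C.rootAd K (2 • r.1 + 1 • s.1)⁆ =
      -(3 • (c ^ 3 * u ^ 2 * C.chainConst r.1 s.1 3 * C.structConst s.1 (3 • r.1 + s.1)) •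
        C.rootAd K (3 • r.1 + 2 • s.1)) := by
  rw [C.lie_smul_rootAd_smul_add_smul h₁ h₂ _ _ (by decide), ← smul_assoc]
  refine Eq.trans ?_ (neg_smul _ _)
  congr 1
  have hM := congrArg (Int.cast : ℤ → K) (C.three_mul_chainConst_three h₁ h₂)
  have hJ := congrArg (Int.cast : ℤ → K) (C.structConst_mul_structConst_add h₁ h₂)
  rw [one_smul, one_smul, C.chainConst_one]
  push_cast at hM hJ
  rw [nsmul_eq_mul, Nat.cast_ofNat]
  linear_combination c ^ 3 * u ^ 2 * C.chainConst r.1 s.1 2 * hJ +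
    c ^ 3 * u ^ 2 * C.structConst s.1 (3 • r.1 + s.1) * hM

theorem lie_smul_rootAd_chain_three (h₁ : s ≠ r) (h₂ : s ≠ -r) (c u : K) :
    ⁅u • C.rootAd K (0 • r.1 + 1 • s.1),
        (c ^ 3 * u * C.chainConst r.1 s.1 3) • C.rootAd K (3 • r.1 + 1 • s.1)⁆ =
      (c ^ 3 * u ^ 2 * C.chainConst r.1 s.1 3 * C.structConst s.1 (3 • r.1 + s.1)) •
        C.rootAd K (3 • r.1 + 2 • s.1) := by
  rw [C.lie_smul_rootAd_smul_add_smul h₁ h₂ _ _ (by decide), zero_smul, zero_add, one_smul]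
  congr 1
  ring

theorem exp_smul_rootAd_add_chain [Algebra ℚ K] (h₁ : s ≠ r) (h₂ : s ≠ -r)
    (h₁₃ : r.1 + 3 • s.1 ∉ roots) (c u : K) :
    IsNilpotent.exp (∑ i ∈ Finset.range 4,
        (c ^ i * u * C.chainConst r.1 s.1 i) • C.rootAd K (i • r.1 + s.1)) =
      C.rootExp s.1 u * C.wordExp (C.commWord r.1 s.1 c u) := by
  have h₂₃ : 2 • r.1 + 3 • s.1 ∉ roots := fun h => h₁₃ (add_three_smul_mem_roots r s h₂ h)
  have hcomm {i j k l : ℕ} (x y : K) (hi : i + k ∈ Finset.Icc 1 6) (hj : j + l ∈ Finset.Icc 1 4)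
      (hij : (i + k, j + l) ∉ [(1, 1), (2, 1), (1, 2), (3, 1), (1, 3), (3, 2), (2, 3)]) :=
    C.commute_smul_rootAd_smul_add_smul h₁ h₂ x y (by simp only [Finset.mem_Icc] at hj; omega)
      fun h => hij (mem_of_smul_add_smul_mem_roots r s h₂ _ hi _ hj h)
  have hnil (z : K) (v : ℤ × ℤ) : IsNilpotent (z • C.rootAd K v) := (C.isNilpotent_rootAd v).smul z
  have key := exp_add_add_add_of_lie (hnil u (0 • r.1 + 1 • s.1)) (hnil _ (1 • r.1 + 1 • s.1))
    (hnil (c ^ 2 * u * C.chainConst r.1 s.1 2) (2 • r.1 + 1 • s.1))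
    (hnil _ (3 • r.1 + 1 • s.1)) (hnil _ (1 • r.1 + 2 • s.1)) (hnil _ (3 • r.1 + 2 • s.1))
    (C.lie_smul_rootAd_chain_one h₁ h₂ c u)
    (hcomm _ _ (by decide) (by decide) (by decide)).lie_eq
    (C.lie_smul_rootAd_chain_three h₁ h₂ c u)
    (C.lie_smul_rootAd_chain_one_two h₁ h₂ c u)
    (hcomm _ _ (by decide) (by decide) (by decide)).lie_eq
    (hcomm _ _ (by decide) (by decide) (by decide))
    (by
      simp only [List.forall_mem_cons, List.not_mem_nil, false_implies, implies_true, and_true]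
      exact ⟨C.commute_smul_rootAd_smul_add_smul h₁ h₂ _ _ (by decide) (by simpa),
        C.commute_smul_rootAd_smul_add_smul h₁ h₂ _ _ (by decide) h₂₃,
        hcomm _ _ (by decide) (by decide) (by decide),
        hcomm _ _ (by decide) (by decide) (by decide)⟩)
    (by
      simp only [List.forall_mem_cons, List.not_mem_nil, false_implies, implies_true, and_true]
      and_intros <;> exact hcomm _ _ (by decide) (by decide) (by decide))
  simp only [one_smul, zero_smul, zero_add] at key
  simp only [wordExp, commWord, List.map_cons, List.map_nil, List.prod_cons, List.prod_nil,
    mul_one, ← mul_assoc, C.rootExp_eq_exp, ← key, Finset.sum_range_succ', Finset.sum_range_zero,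
    Nat.reduceAdd, chainConst_zero, zero_add, one_smul, zero_smul, pow_one, pow_zero, one_mul,
    Int.cast_one]
  congr 1
  abel

theorem rootExp_commutator_of_rat [Algebra ℚ K] (h₁ : s ≠ r) (h₂ : s ≠ -r)
    (h₁₃ : r.1 + 3 • s.1 ∉ roots) (t u : K) :
    C.rootExp s.1 (-u) * C.rootExp r.1 (-t) * C.rootExp s.1 u * C.rootExp r.1 t =
      C.wordExp (C.commWord r.1 s.1 (-t) u) := by
  have hconj : C.rootExp r.1 (-t) * C.rootExp s.1 u * C.rootExp r.1 t =
      C.rootExp s.1 u * C.wordExp (C.commWord r.1 s.1 (-t) u) := by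
    have hexp := exp_mul_exp_mul_exp_neg ((C.isNilpotent_rootAd (K := K) r.1).smul (-t))
      ((C.isNilpotent_rootAd (K := K) s.1).smul u)
    rwa [C.exp_ad_smul_rootAd h₁ h₂, ← neg_smul, neg_neg, ← C.rootExp_eq_exp, ← C.rootExp_eq_exp,
      ← C.rootExp_eq_exp, C.exp_smul_rootAd_add_chain h₁ h₂ h₁₃] at hexp
  calc C.rootExp s.1 (-u) * C.rootExp r.1 (-t) * C.rootExp s.1 u * C.rootExp r.1 t
    _ = C.rootExp s.1 (-u) * (C.rootExp r.1 (-t) * C.rootExp s.1 u * C.rootExp r.1 t) := by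
      simp only [mul_assoc]
    _ = C.wordExp (C.commWord r.1 s.1 (-t) u) := by
      rw [hconj, ← mul_assoc, C.rootExp_mul, neg_add_cancel, C.rootExp_zero, one_mul]

end CommutatorFormula

section BaseChange

variable {R : Type*} [CommRing R]

/-- The base change map `L_R → L_K` along a ring homomorphism `R → K`. -/
noncomputable def formMap (f : R →+* K) : C.Form R →ₗ[ℤ] C.Form K :=
  f.toIntAlgHom.toLinearMap.rTensor C.lattice

theorem formMap_tmul (f : R →+* K) (z : R) (y : C.lattice) :
    C.formMap f (z ⊗ₜ y) = f z ⊗ₜ y := rfl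

theorem formMap_injective {f : R →+* K} (hf : Function.Injective f) :
    Function.Injective (C.formMap f) := by
  have : IsAddTorsionFree L := .of_isTorsionFree ℂ L
  exact Module.Flat.rTensor_preserves_injective_linearMap _ hf

theorem formMap_rootExp (f : R →+* K) (v : ℤ × ℤ) (z : R) (y : C.Form R) :
    C.formMap f (C.rootExp v z y) = C.rootExp v (f z) (C.formMap f y) := by
  by_cases hv : v ∈ roots
  · lift v to Root using hv
    induction y using TensorProduct.induction_on with
    | zero => simp
    | add y y' hy hy' => simp only [map_add, hy, hy']
    | tmul c y =>
      simp [rootExp_coe, rootEnd, formMap_tmul, Finset.sum_apply, TensorProduct.smul_tmul']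
  · rw [C.rootExp_of_notMem hv, C.rootExp_of_notMem hv, Module.End.one_apply, Module.End.one_apply]

theorem formMap_wordExp (f : R →+* K) (l : List ((ℤ × ℤ) × R)) (y : C.Form R) :
    C.formMap f (C.wordExp l y) = C.wordExp (l.map (Prod.map id f)) (C.formMap f y) := by
  induction l with
  | nil => simp [wordExp]
  | cons p l ih =>
    simp only [wordExp, List.map_cons, List.prod_cons, Module.End.mul_apply] at ih ⊢
    rw [C.formMap_rootExp, ih]
    rfl

theorem wordExp_map_eq {f : R →+* K} {l l' : List ((ℤ × ℤ) × R)}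
    (h : C.wordExp l = C.wordExp l') :
    C.wordExp (l.map (Prod.map id f)) = C.wordExp (l'.map (Prod.map id f)) := by
  ext y
  have hmap := congrArg (C.formMap f) (LinearMap.congr_fun h (1 ⊗ₜ y))
  rw [C.formMap_wordExp, C.formMap_wordExp, C.formMap_tmul, map_one] at hmap
  simpa using hmap

theorem wordExp_eq_of_map_eq {f : R →+* K} (hf : Function.Injective f)
    {l l' : List ((ℤ × ℤ) × R)}
    (h : C.wordExp (l.map (Prod.map id f)) = C.wordExp (l'.map (Prod.map id f))) :
    C.wordExp l = C.wordExp l' :=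
  LinearMap.ext fun y => C.formMap_injective hf <| by
    rw [C.formMap_wordExp, C.formMap_wordExp, h]

theorem commWord_map (f : R →+* K) (v w : ℤ × ℤ) (c u : R) :
    (C.commWord v w c u).map (Prod.map id f) = C.commWord v w (f c) (f u) := by
  simp [commWord]

open MvPolynomial in
theorem rootExp_commutator {r s : Root} (h₁ : s ≠ r) (h₂ : s ≠ -r)
    (h₁₃ : r.1 + 3 • s.1 ∉ roots) (t u : K) :
    C.rootExp s.1 (-u) * C.rootExp r.1 (-t) * C.rootExp s.1 u * C.rootExp r.1 t =
      C.wordExp (C.commWord r.1 s.1 (-t) u) := by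
  have huniv : C.wordExp [(s.1, -X 1), (r.1, -X 0), (s.1, X 1), (r.1, X 0)] =
      C.wordExp (C.commWord r.1 s.1 (-X 0 : MvPolynomial (Fin 2) ℤ) (X 1)) := by
    refine C.wordExp_eq_of_map_eq (MvPolynomial.map_injective (Int.castRingHom ℚ)
      Int.cast_injective) ?_
    rw [commWord_map]
    simpa [wordExp, mul_assoc] using
      C.rootExp_commutator_of_rat h₁ h₂ h₁₃ (X 0 : MvPolynomial (Fin 2) ℚ) (X 1)
  have hK := C.wordExp_map_eq (f := (aeval ![t, u]).toRingHom) huniv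
  rw [commWord_map] at hK
  simpa [wordExp, mul_assoc] using hK

end BaseChange

section RootElements

/-- The root element `x_v(z)` of the Chevalley group, extended by `1` to the root lattice. -/
noncomputable def rootElt (v : ℤ × ℤ) (z : K) : C.chevalleyGroup K :=
  if h : v ∈ roots then C.x v.1 v.2 z h else 1

theorem rootElt_of_notMem {v : ℤ × ℤ} (h : v ∉ roots) (z : K) : C.rootElt v z = 1 := dif_neg h

theorem x_eq_rootElt (m n : ℤ) (z : K) (h : (m, n) ∈ roots) :
    C.x m n z h = C.rootElt (m, n) z :=
  (dif_pos h).symm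

variable (K) in
/-- The action of the Chevalley group on `L_K`. -/
noncomputable def toEnd : C.chevalleyGroup K →* Module.End K (C.Form K) :=
  LinearEquiv.automorphismGroup.toLinearMapMonoidHom.comp (C.chevalleyGroup K).subtype

theorem toEnd_injective : Function.Injective (C.toEnd K) := fun _ _ h =>
  Subtype.ext (LinearEquiv.toLinearMap_injective h)

theorem toEnd_rootElt (v : ℤ × ℤ) (z : K) : C.toEnd K (C.rootElt v z) = C.rootExp v z := by
  by_cases hv : v ∈ roots
  · rw [rootElt, dif_pos hv, rootExp, dif_pos hv]
    rfl
  · rw [C.rootElt_of_notMem hv, C.rootExp_of_notMem hv, map_one]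

theorem rootElt_mul (v : ℤ × ℤ) (y z : K) :
    C.rootElt v y * C.rootElt v z = C.rootElt v (y + z) := by
  refine C.toEnd_injective ?_
  simp only [map_mul, toEnd_rootElt, rootExp_mul]

theorem rootElt_zero (v : ℤ × ℤ) : C.rootElt v (0 : K) = 1 :=
  C.toEnd_injective (by rw [toEnd_rootElt, rootExp_zero, map_one])

theorem rootElt_inv (v : ℤ × ℤ) (z : K) : (C.rootElt v z)⁻¹ = C.rootElt v (-z) := by
  rw [inv_eq_iff_mul_eq_one, rootElt_mul, add_neg_cancel, rootElt_zero]

variable {r s : Root}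

theorem comm_rootElt_of_notMem (h₁ : s ≠ r) (h₂ : s ≠ -r) (h₁₃ : r.1 + 3 • s.1 ∉ roots) (t u : K) :
    comm (C.rootElt s.1 u) (C.rootElt r.1 t) =
      C.rootElt (r.1 + s.1) (-t * u * C.chainConst r.1 s.1 1) *
        C.rootElt (2 • r.1 + s.1) ((-t) ^ 2 * u * C.chainConst r.1 s.1 2) *
        C.rootElt (3 • r.1 + s.1) ((-t) ^ 3 * u * C.chainConst r.1 s.1 3) *
        C.rootElt (r.1 + 2 • s.1) (-t * u ^ 2 * C.chainConst s.1 r.1 2) *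
        C.rootElt (3 • r.1 + 2 • s.1)
          ((-t) ^ 3 * u ^ 2 * C.chainConst r.1 s.1 3 * C.structConst s.1 (3 • r.1 + s.1)) := by
  refine C.toEnd_injective ?_
  simpa [comm, rootElt_inv, toEnd_rootElt, wordExp, commWord, mul_assoc] using
    C.rootExp_commutator h₁ h₂ h₁₃ t u

theorem comm_rootElt_eq_rootElt (h₁ : s ≠ r) (h₂ : s ≠ -r) (h₂₁ : 2 • r.1 + s.1 ∉ roots)
    (h₁₂ : r.1 + 2 • s.1 ∉ roots) (t u : K) :
    comm (C.rootElt s.1 u) (C.rootElt r.1 t) =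
      C.rootElt (r.1 + s.1) (-(t * u * C.structConst r.1 s.1)) := by
  obtain ⟨h₃₁, h₁₃, h₃₂⟩ := smul_add_smul_notMem_roots r s h₂₁ h₁₂
  rw [C.comm_rootElt_of_notMem h₁ h₂ h₁₃, C.rootElt_of_notMem h₂₁, C.rootElt_of_notMem h₃₁,
    C.rootElt_of_notMem h₁₂, C.rootElt_of_notMem h₃₂, mul_one, mul_one, mul_one, mul_one,
    C.chainConst_one, neg_mul, neg_mul]

theorem commute_rootElt {v w : ℤ × ℤ} (h₀ : v + w ≠ 0) (h : v + w ∉ roots) (y z : K) :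
    Commute (C.rootElt v y) (C.rootElt w z) := by
  by_cases hv : v ∈ roots
  swap
  · rw [C.rootElt_of_notMem hv]; exact .one_left _
  by_cases hw : w ∈ roots
  swap
  · rw [C.rootElt_of_notMem hw]; exact .one_right _
  lift v to Root using hv
  lift w to Root using hw
  rcases eq_or_ne v w with rfl | h₁
  · rw [commute_iff_eq, rootElt_mul, rootElt_mul, add_comm]
  have h₂ : v ≠ -w := fun hvw => h₀ (by rw [hvw]; exact neg_add_cancel w.1)
  rw [add_comm] at h
  obtain ⟨h₂₁, h₁₂⟩ := two_smul_add_notMem_roots w v h₂ h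
  rw [← comm_eq_one_iff, C.comm_rootElt_eq_rootElt h₁ h₂ h₂₁ h₁₂, C.rootElt_of_notMem h]

theorem rootElt_mul_rootElt_chain (h₁ : s ≠ r) (h₂ : s ≠ -r) (h₁₃ : r.1 + 3 • s.1 ∈ roots)
    (t u : K) :
    C.rootElt (r.1 + 2 • s.1) (-(C.chainConst s.1 r.1 2) * t * u ^ 2) *
        C.rootElt (r.1 + s.1) (-(C.chainConst r.1 s.1 1) * t * u) =
      C.rootElt (r.1 + s.1) (-(C.chainConst r.1 s.1 1) * t * u) *
        C.rootElt (r.1 + 2 • s.1) (-(C.chainConst s.1 r.1 2) * t * u ^ 2) *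
        C.rootElt (2 • r.1 + 3 • s.1)
          (-(3 * C.chainConst s.1 r.1 3 * C.structConst r.1 (r.1 + 3 • s.1)) * t ^ 2 * u ^ 3) := by
  obtain ⟨h₁₁, h₁₂⟩ := add_mem_roots_of_add_three_smul r s h₁₃
  obtain ⟨hleft, hright⟩ := two_smul_add_notMem_roots_of_add_three_smul r s h₁₃
  have hadd : r.1 + s.1 + (r.1 + 2 • s.1) = 2 • r.1 + 3 • s.1 := by abel
  have hne : r.1 + 2 • s.1 ≠ r.1 + s.1 := fun h => by
    have hs : s.1 = 0 := add_eq_left.1 ((two_nsmul s.1).symm.trans (add_left_cancel h))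
    exact absurd (hs ▸ s.2) (by decide)
  have hne' : r.1 + 2 • s.1 ≠ -(r.1 + s.1) := fun h =>
    smul_add_smul_ne_zero h₁ h₂ 2 three_ne_zero (hadd ▸ by rw [h, add_neg_cancel])
  have hcomm := C.comm_rootElt_eq_rootElt (r := ⟨_, h₁₁⟩) (s := ⟨_, h₁₂⟩)
    (mt (congrArg Subtype.val) hne) (mt (congrArg Subtype.val) hne') hleft hright
    (-(C.chainConst r.1 s.1 1) * t * u) (-(C.chainConst s.1 r.1 2) * t * u ^ 2)
  have hM := congrArg (Int.cast : ℤ → K) (C.chainConst_mul_structConst h₁ h₂)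
  push_cast at hM
  rw [mul_eq_mul_mul_comm, hcomm, ← hadd]
  congr 2
  linear_combination -t ^ 2 * u ^ 3 * hM

theorem comm_rootElt_of_mem (h₁ : s ≠ r) (h₂ : s ≠ -r) (h₁₃ : r.1 + 3 • s.1 ∈ roots) (t u : K) :
    comm (C.rootElt s.1 u) (C.rootElt r.1 t) =
      C.rootElt (r.1 + s.1) (-(C.chainConst r.1 s.1 1) * t * u) *
        C.rootElt (r.1 + 2 • s.1) (-(C.chainConst s.1 r.1 2) * t * u ^ 2) *
        C.rootElt (r.1 + 3 • s.1) (C.chainConst s.1 r.1 3 * t * u ^ 3) *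
        C.rootElt (2 • r.1 + 3 • s.1)
          (-(2 * C.chainConst s.1 r.1 3 * C.structConst r.1 (r.1 + 3 • s.1)) * t ^ 2 * u ^ 3) := by
  obtain ⟨h₂₁, h₃₁, -⟩ := notMem_roots_of_add_three_smul r s h₁₃
  rw [add_comm] at h₂₁ h₃₁
  have hsum := add_notMem_roots_of_add_three_smul r s h₁₃
  simp only [List.forall_mem_cons, List.not_mem_nil, false_implies, implies_true, and_true] at hsum
  obtain ⟨⟨e₁₃, e₁₄⟩, ⟨e₂₃, e₂₄⟩, -, e₃₄⟩ := hsum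
  have hM : C.chainConst s.1 r.1 1 = -C.chainConst r.1 s.1 1 := by
    rw [C.chainConst_one, C.chainConst_one, C.structConst_swap]
  have hswap : comm (C.rootElt s.1 u) (C.rootElt r.1 t) =
      C.rootElt (2 • r.1 + 3 • s.1)
          (C.chainConst s.1 r.1 3 * C.structConst r.1 (r.1 + 3 • s.1) * t ^ 2 * u ^ 3) *
        C.rootElt (r.1 + 3 • s.1) (C.chainConst s.1 r.1 3 * t * u ^ 3) *
        C.rootElt (r.1 + 2 • s.1) (-(C.chainConst s.1 r.1 2) * t * u ^ 2) *
        C.rootElt (r.1 + s.1) (-(C.chainConst r.1 s.1 1) * t * u) := by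
    rw [← comm_inv, C.comm_rootElt_of_notMem h₁.symm (ne_neg_symm h₂) h₃₁,
      C.rootElt_of_notMem h₂₁, mul_one]
    simp only [mul_inv_rev, rootElt_inv, hM, add_comm _ r.1, add_comm _ (2 • r.1), mul_assoc]
    push_cast
    ring_nf
  rw [hswap, mul_reverse_of_commute (C.rootElt_mul_rootElt_chain h₁ h₂ h₁₃ t u)
    (C.commute_rootElt e₁₃.1 e₁₃.2 _ _) (C.commute_rootElt e₂₃.1 e₂₃.2 _ _)
    (C.commute_rootElt e₁₄.1 e₁₄.2 _ _) (C.commute_rootElt e₂₄.1 e₂₄.2 _ _)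
    (C.commute_rootElt e₃₄.1 e₃₄.2 _ _), rootElt_mul]
  congr 2
  ring

theorem comm_rootElt {v w : ℤ × ℤ} (hv : v ∈ roots) (hw : w ∈ roots) (h₁ : w ≠ v) (h₂ : w ≠ -v)
    (t u : K) :
    comm (C.rootElt w u) (C.rootElt v t) =
      C.rootElt (v + w) (-(C.chainConst v w 1) * t * u) *
        C.rootElt (2 • v + w) (C.chainConst v w 2 * t ^ 2 * u) *
        C.rootElt (3 • v + w) (-(C.chainConst v w 3) * t ^ 3 * u) *
        C.rootElt (v + 2 • w) (-(C.chainConst w v 2) * t * u ^ 2) *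
        C.rootElt (v + 3 • w) (C.chainConst w v 3 * t * u ^ 3) *
        C.rootElt (3 • v + 2 • w)
          (-(C.chainConst v w 3 * C.structConst w (3 • v + w)) * t ^ 3 * u ^ 2) *
        C.rootElt (2 • v + 3 • w)
          (-(2 * C.chainConst w v 3 * C.structConst v (v + 3 • w)) * t ^ 2 * u ^ 3) := by
  lift v to Root using hv
  lift w to Root using hw
  replace h₁ : w ≠ v := fun h => h₁ (congrArg Subtype.val h)
  replace h₂ : w ≠ -v := fun h => h₂ (congrArg Subtype.val h)
  by_cases h₁₃ : v.1 + 3 • w.1 ∈ roots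
  · obtain ⟨h₂₁, h₃₁, h₃₂⟩ := notMem_roots_of_add_three_smul v w h₁₃
    rw [C.comm_rootElt_of_mem h₁ h₂ h₁₃, C.rootElt_of_notMem h₂₁, C.rootElt_of_notMem h₃₁,
      C.rootElt_of_notMem h₃₂, mul_one, mul_one, mul_one]
  · have h₂₃ : 2 • v.1 + 3 • w.1 ∉ roots := fun h => h₁₃ (add_three_smul_mem_roots v w h₂ h)
    rw [C.comm_rootElt_of_notMem h₁ h₂ h₁₃, C.rootElt_of_notMem h₁₃, C.rootElt_of_notMem h₂₃,
      mul_one, mul_one]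
    ring_nf

end RootElements

end ChevalleyBasis

end G2

set_option maxHeartbeats 4000000 in
-- All relations are instances of one formula, evaluated root by root.
theorem mainTheorem4 {L : Type*} [LieRing L] [LieAlgebra ℂ L] (C : ChevalleyBasis L)
    (hab : 0 < C.N (rt 1 0) (rt 0 1)) (ha_ab : 0 < C.N (rt 1 0) (rt 1 1))
    (ha_2ab : 0 < C.N (rt 1 0) (rt 2 1)) (hb_3ab : 0 < C.N (rt 0 1) (rt 3 1))
    {K : Type*} [CommRing K] (t u : K) :
    comm (C.x 0 1 u) (C.x 1 0 t) =
      C.x 1 1 (-(t * u)) * C.x 2 1 (t ^ 2 * u) * C.x 3 1 (-(t ^ 3 * u)) *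
        C.x 3 2 (-(t ^ 3 * u ^ 2)) ∧
    comm (C.x 1 0 u) (C.x 0 1 t) =
      C.x 1 1 (t * u) * C.x 2 1 (-(t * u ^ 2)) * C.x 3 1 (t * u ^ 3) *
        C.x 3 2 (-(2 * t ^ 2 * u ^ 3)) ∧
    comm (C.x 1 1 u) (C.x 1 0 t) =
      C.x 2 1 (-(2 * t * u)) * C.x 3 1 (3 * t ^ 2 * u) * C.x 3 2 (-(3 * t * u ^ 2)) ∧
    comm (C.x 2 1 u) (C.x 1 0 t) =
      C.x 3 1 (-(3 * t * u)) ∧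
    comm (C.x 3 1 u) (C.x 0 1 t) =
      C.x 3 2 (-(t * u)) ∧
    comm (C.x 2 1 u) (C.x 1 1 t) =
      C.x 3 2 (3 * t * u) ∧
    comm (C.x 0 (-1) u) (C.x (-1) 0 t) =
      C.x (-1) (-1) (t * u) * C.x (-2) (-1) (t ^ 2 * u) *
        C.x (-3) (-1) (t ^ 3 * u) * C.x (-3) (-2) (-(t ^ 3 * u ^ 2)) ∧
    comm (C.x (-1) 0 u) (C.x 0 (-1) t) =
      C.x (-1) (-1) (-(t * u)) * C.x (-2) (-1) (-(t * u ^ 2)) *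
        C.x (-3) (-1) (-(t * u ^ 3)) * C.x (-3) (-2) (-(2 * t ^ 2 * u ^ 3)) ∧
    comm (C.x (-1) (-1) u) (C.x (-1) 0 t) =
      C.x (-2) (-1) (2 * t * u) * C.x (-3) (-1) (3 * t ^ 2 * u) *
        C.x (-3) (-2) (-(3 * t * u ^ 2)) ∧
    comm (C.x (-2) (-1) u) (C.x (-1) 0 t) =
      C.x (-3) (-1) (3 * t * u) ∧
    comm (C.x (-3) (-1) u) (C.x 0 (-1) t) =
      C.x (-3) (-2) (t * u) ∧
    comm (C.x (-2) (-1) u) (C.x (-1) (-1) t) =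
      C.x (-3) (-2) (-(3 * t * u)) ∧
    comm (C.x (-1) (-1) u) (C.x 1 0 t) =
      C.x 0 (-1) (3 * t * u) ∧
    comm (C.x (-2) (-1) u) (C.x 1 0 t) =
      C.x (-1) (-1) (2 * t * u) * C.x 0 (-1) (3 * t ^ 2 * u) *
        C.x (-3) (-2) (3 * t * u ^ 2) ∧
    comm (C.x (-3) (-1) u) (C.x 1 0 t) =
      C.x (-2) (-1) (t * u) * C.x (-1) (-1) (t ^ 2 * u) *
        C.x 0 (-1) (t ^ 3 * u) * C.x (-3) (-2) (t ^ 3 * u ^ 2) ∧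
    comm (C.x 1 0 u) (C.x (-3) (-1) t) =
      C.x (-2) (-1) (-(t * u)) * C.x (-1) (-1) (-(t * u ^ 2)) *
        C.x 0 (-1) (-(t * u ^ 3)) * C.x (-3) (-2) (2 * t ^ 2 * u ^ 3) ∧
    comm (C.x 0 1 u) (C.x (-1) (-1) t) =
      C.x (-1) 0 (t * u) * C.x (-2) (-1) (-(t ^ 2 * u)) *
        C.x (-3) (-2) (t ^ 3 * u) * C.x (-3) (-1) (-(t ^ 3 * u ^ 2)) ∧
    comm (C.x (-1) (-1) u) (C.x 0 1 t) =
      C.x (-1) 0 (-(t * u)) * C.x (-2) (-1) (t * u ^ 2) *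
        C.x (-3) (-2) (-(t * u ^ 3)) * C.x (-3) (-1) (-(2 * t ^ 2 * u ^ 3)) ∧
    comm (C.x (-3) (-2) u) (C.x 0 1 t) =
      C.x (-3) (-1) (t * u) ∧
    comm (C.x (-1) 0 u) (C.x 1 1 t) =
      C.x 0 1 (3 * t * u) ∧
    comm (C.x 0 (-1) u) (C.x 1 1 t) =
      C.x 1 0 (-(t * u)) * C.x 2 1 (-(t ^ 2 * u)) * C.x 3 2 (-(t ^ 3 * u)) *
        C.x 3 1 (-(t ^ 3 * u ^ 2)) ∧
    comm (C.x 1 1 u) (C.x 0 (-1) t) =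
      C.x 1 0 (t * u) * C.x 2 1 (t * u ^ 2) * C.x 3 2 (t * u ^ 3) *
        C.x 3 1 (-(2 * t ^ 2 * u ^ 3)) ∧
    comm (C.x (-2) (-1) u) (C.x 1 1 t) =
      C.x (-1) 0 (-(2 * t * u)) * C.x 0 1 (-(3 * t ^ 2 * u)) *
        C.x (-3) (-1) (3 * t * u ^ 2) ∧
    comm (C.x (-3) (-2) u) (C.x 1 1 t) =
      C.x (-2) (-1) (-(t * u)) * C.x (-1) 0 (t ^ 2 * u) * C.x 0 1 (t ^ 3 * u) *
        C.x (-3) (-1) (t ^ 3 * u ^ 2) ∧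
    comm (C.x 1 1 u) (C.x (-3) (-2) t) =
      C.x (-2) (-1) (t * u) * C.x (-1) 0 (-(t * u ^ 2)) *
        C.x 0 1 (-(t * u ^ 3)) * C.x (-3) (-1) (2 * t ^ 2 * u ^ 3) ∧
    comm (C.x (-1) 0 u) (C.x 2 1 t) =
      C.x 1 1 (2 * t * u) * C.x 3 2 (-(3 * t ^ 2 * u)) * C.x 0 1 (-(3 * t * u ^ 2)) ∧
    comm (C.x (-1) (-1) u) (C.x 2 1 t) =
      C.x 1 0 (-(2 * t * u)) * C.x 3 1 (-(3 * t ^ 2 * u)) *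
        C.x 0 (-1) (3 * t * u ^ 2) ∧
    comm (C.x (-3) (-1) u) (C.x 2 1 t) =
      C.x (-1) 0 (-(t * u)) * C.x 1 1 (-(t ^ 2 * u)) * C.x 3 2 (t ^ 3 * u) *
        C.x 0 1 (-(t ^ 3 * u ^ 2)) ∧
    comm (C.x 2 1 u) (C.x (-3) (-1) t) =
      C.x (-1) 0 (t * u) * C.x 1 1 (t * u ^ 2) * C.x 3 2 (-(t * u ^ 3)) *
        C.x 0 1 (-(2 * t ^ 2 * u ^ 3)) ∧
    comm (C.x (-3) (-2) u) (C.x 2 1 t) =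
      C.x (-1) (-1) (t * u) * C.x 1 0 (-(t ^ 2 * u)) * C.x 3 1 (-(t ^ 3 * u)) *
        C.x 0 (-1) (t ^ 3 * u ^ 2) ∧
    comm (C.x 2 1 u) (C.x (-3) (-2) t) =
      C.x (-1) (-1) (-(t * u)) * C.x 1 0 (t * u ^ 2) * C.x 3 1 (t * u ^ 3) *
        C.x 0 (-1) (2 * t ^ 2 * u ^ 3) ∧
    comm (C.x (-1) 0 u) (C.x 3 1 t) =
      C.x 2 1 (t * u) * C.x 1 1 (-(t * u ^ 2)) * C.x 0 1 (t * u ^ 3) *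
        C.x 3 2 (2 * t ^ 2 * u ^ 3) ∧
    comm (C.x 3 1 u) (C.x (-1) 0 t) =
      C.x 2 1 (-(t * u)) * C.x 1 1 (t ^ 2 * u) * C.x 0 1 (-(t ^ 3 * u)) *
        C.x 3 2 (t ^ 3 * u ^ 2) ∧
    comm (C.x (-2) (-1) u) (C.x 3 1 t) =
      C.x 1 0 (-(t * u)) * C.x (-1) (-1) (t * u ^ 2) *
        C.x (-3) (-2) (t * u ^ 3) * C.x 0 (-1) (-(2 * t ^ 2 * u ^ 3)) ∧
    comm (C.x 3 1 u) (C.x (-2) (-1) t) =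
      C.x 1 0 (t * u) * C.x (-1) (-1) (-(t ^ 2 * u)) *
        C.x (-3) (-2) (-(t ^ 3 * u)) * C.x 0 (-1) (-(t ^ 3 * u ^ 2)) ∧
    comm (C.x (-3) (-2) u) (C.x 3 1 t) =
      C.x 0 (-1) (-(t * u)) ∧
    comm (C.x (-1) (-1) u) (C.x 3 2 t) =
      C.x 2 1 (-(t * u)) * C.x 1 0 (-(t * u ^ 2)) * C.x 0 (-1) (t * u ^ 3) *
        C.x 3 1 (2 * t ^ 2 * u ^ 3) ∧
    comm (C.x 3 2 u) (C.x (-1) (-1) t) =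
      C.x 2 1 (t * u) * C.x 1 0 (t ^ 2 * u) * C.x 0 (-1) (-(t ^ 3 * u)) *
        C.x 3 1 (t ^ 3 * u ^ 2) ∧
    comm (C.x (-2) (-1) u) (C.x 3 2 t) =
      C.x 1 1 (t * u) * C.x (-1) 0 (t * u ^ 2) * C.x (-3) (-1) (-(t * u ^ 3)) *
        C.x 0 1 (2 * t ^ 2 * u ^ 3) ∧
    comm (C.x 3 2 u) (C.x (-2) (-1) t) =
      C.x 1 1 (-(t * u)) * C.x (-1) 0 (-(t ^ 2 * u)) *
        C.x (-3) (-1) (t ^ 3 * u) * C.x 0 1 (t ^ 3 * u ^ 2) ∧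
    comm (C.x (-3) (-1) u) (C.x 3 2 t) =
      C.x 0 1 (-(t * u)) := by
  have hC : C.IsExtraspecialPos := ⟨hab, ha_ab, ha_2ab, hb_3ab⟩
  simp only [ChevalleyBasis.x_eq_rootElt]
  and_intros
  all_goals
    simp (decide := true) [C.comm_rootElt, ChevalleyBasis.chainConst, hC.structConst_eq,
      extraspecialConst, Finset.prod_range_succ, ChevalleyBasis.rootElt_of_notMem, Nat.factorial]
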